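/- **Setting.** Let $\mathfrak m=(m_k)_{k\ge 1}$ with $0<m_k\le\varepsilon_0$, let $\mathfrak p=(p_k)_{k\ge1}$ be points of $\mathbb R^3$ with $|p_i-p_j|\ge 5$ for $i\ne j$, let $\lambda\ge 1$, $c_k=\lambda p_k$, $B_k=\{x:|x-c_k|<2\}$, and let $\widehat\delta_k>0$ satisfy $$\sum_{\ell\ne k}\frac{m_\ell}{|p_k-p_\ell|}\le\widehat\delta_k\quad\text{for all }k .$$ Let $g$ be a complete smooth Riemannian metric on $\mathbb R^3$ with vanishing scalar curvature such that $$g_{ij}(x)=\Big(1+\sum_{\ell}\frac{m_\ell}{2|x-c_\ell|}\Big)^4\delta_{ij}\quad\text{whenever } |x-c_k|>2 \text{ for all } k,$$ and such that, for some constant $C>0$, $|\partial^I_x(g_{ij}(x)-\delta_{ij})|\le C m_k$ for all $k$, all $x\in B_k$ and all multi-indices $|I|\le 2$. Define the flux $$\mathcal F(r)=\int_{\{|x|=r\}}\sum_{a,b,j=1}^3 g^{ab}\,(g_{aj,b}-g_{ab,j})\,\frac{x^j}{|x|}\,dA ,$$ where $dA$ is Euclidean surface measure. For $r>0$ put $B_k^r=\{x:|x-c_k|<r/10\}$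 and $S_r=\{|x|=r\}$. **Proposition.** There is a universal constant $\eta>0$ such that the following holds for all data as above with $\sum_k\widehat\delta_k<\infty$. 1. Suppose $\mathfrak m\notin\ell^1$ and $\#\{k:B_k\cap S_r\neq\varnothing\}$ is bounded uniformly in $r>0$. If $g$ is uniformly positive, i.e. $g(x)(v,v)\ge\kappa|v|^2$ for some $\kappa>0$ and all $x,v\in\mathbb R^3$ (which is automatic when $C\varepsilon_0<\tfrac13$), then $\lim_{r\to\infty}\mathcal F(r)=+\infty$. Moreover $g$ is not asymptotically flat in the coordinates $x$: there is no $\tau>\tfrac12$ with $g_{ij}-\delta_{ij}=O(|x|^{-\tau})$ and $\partial_l g_{ij}=O(|x|^{-\tau-1})$ as $|x|\to\infty$ for all $i,j,l$. 2. Suppose $\mathfrak m\in\ell^1$. Then $\lim_{r\to\infty}\mathcal F(r)$ exists and is finite. In this case: * if $\sum_k\widehat\delta_k<\eta$, the limit is strictly positive; * if $\#\{k:B_k^r\cap S_r\ne\varnothing\}$ is bounded uniformly in $r>0$, and $|c_k-c_j|\ge\tfrac27|c_j|$ for all $j<k$, then the limit equals $16\pi\|\mathfrak m\|_{\ell^1}$.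 -/

import Mathlib

open Filter Topology MeasureTheory
open scoped ContDiff

/-- Euclidean three-space with its Cartesian coordinates `x 0, x 1, x 2`. -/
abbrev E3 : Type := EuclideanSpace ℝ (Fin 3)

/-- A field of `3 × 3` matrices on `ℝ³`: the components `g x i j` of a covariant two-tensor in
Cartesian coordinates. -/
abbrev TensorField : Type := E3 → Matrix (Fin 3) (Fin 3) ℝ

noncomputable section

/-- The Cartesian partial derivative `∂f/∂xⁱ`. -/
def pderiv (i : Fin 3) (f : E3 → ℝ) (x : E3) : ℝ :=
  fderiv ℝ f x (EuclideanSpace.single i 1)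

/-- The iterated partial derivative `∂_{i₁} ⋯ ∂_{iₙ} f` for a list `I = [i₁, …, iₙ]` of coordinate
directions; its order is `I.length`. -/
def iterPderiv (I : List (Fin 3)) (f : E3 → ℝ) : E3 → ℝ :=
  I.foldr pderiv f

/-- `g` is a smooth Riemannian metric on `ℝ³`: smooth components, symmetric and positive definite
at every point (`Matrix.PosDef` includes symmetry). -/
structure IsSmoothMetric (g : TensorField) : Prop where
  smooth : ∀ i j, ContDiff ℝ ∞ (fun x => g x i j)
  posDef : ∀ x, (g x).PosDef

/-- The Christoffel symbol `Γᵏᵢⱼ = ½ gᵏˡ (∂ᵢ gⱼₗ + ∂ⱼ gᵢₗ - ∂ₗ gᵢⱼ)`. -/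
def christoffel (g : TensorField) (k i j : Fin 3) (x : E3) : ℝ :=
  (1 / 2) * ∑ l, (g x)⁻¹ k l *
    (pderiv i (fun y => g y j l) x + pderiv j (fun y => g y i l) x - pderiv l (fun y => g y i j) x)

/-- The Ricci tensor `Rᵢⱼ = ∂ₖ Γᵏᵢⱼ - ∂ⱼ Γᵏᵢₖ + Γᵏₖₗ Γˡᵢⱼ - Γᵏⱼₗ Γˡᵢₖ`. -/
def ricci (g : TensorField) (i j : Fin 3) (x : E3) : ℝ :=
  ∑ k, (pderiv k (christoffel g k i j) x - pderiv j (christoffel g k i k) x) +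
  ∑ k, ∑ l, (christoffel g k k l x * christoffel g l i j x -
    christoffel g k j l x * christoffel g l i k x)

/-- The scalar curvature `gⁱʲ Rᵢⱼ`. -/
def scalarCurvature (g : TensorField) (x : E3) : ℝ :=
  ∑ i, ∑ j, (g x)⁻¹ i j * ricci g i j x

/-- The `g`-length of the curve `γ` on the parameter interval `[0, 1]`. -/
def curveLength (g : TensorField) (γ : ℝ → E3) : ℝ :=
  ∫ t in (0 : ℝ)..1, √(∑ i, ∑ j, g (γ t) i j * deriv γ t i * deriv γ t j)

/-- The Riemannian distance: the infimum of the `g`-lengths of the `C¹` curves from `x` to `y`. -/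
def riemDist (g : TensorField) (x y : E3) : ℝ :=
  sInf {s | ∃ γ : ℝ → E3, ContDiff ℝ 1 γ ∧ γ 0 = x ∧ γ 1 = y ∧ s = curveLength g γ}

/-- `g` is complete: Cauchy sequences for the Riemannian distance converge. -/
def IsCompleteMetric (g : TensorField) : Prop :=
  ∀ u : ℕ → E3, (∀ ε > 0, ∃ N, ∀ n ≥ N, ∀ k ≥ N, riemDist g (u n) (u k) < ε) →
    ∃ x, Tendsto (fun n => riemDist g (u n) x) atTop (𝓝 0)

/-- The conformal factor `1 + ∑ₗ mₗ / (2|x - cₗ|)` with masses `m` and centers `c`. -/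
def blFactor (m : ℕ → ℝ) (c : ℕ → E3) (x : E3) : ℝ :=
  1 + ∑' l, m l / (2 * ‖x - c l‖)

/-- The metrics under consideration: `g` is a complete smooth scalar-flat metric on `ℝ³`. Off the
balls of radius `2` about the centers `lam • p k` it is the Brill--Lindquist metric with masses
`m k ∈ (0, ε₀]` and these centers. On the ball about `lam • p k` the components of `g` minus the
Euclidean metric, and their partial derivatives of order at most two, are bounded by `C * m k`.
The points `p k` are separated by at least `5`, and `δ k` bounds the interaction sum
`∑_{l ≠ k} m l / |p k - p l|`. -/
structure IsLocalizedBL (m : ℕ → ℝ) (p : ℕ → E3) (lam : ℝ) (δ : ℕ → ℝ) (ε₀ C : ℝ)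
    (g : TensorField) : Prop where
  mass_pos : ∀ k, 0 < m k
  mass_le : ∀ k, m k ≤ ε₀
  one_le_lam : 1 ≤ lam
  separated : ∀ i j, i ≠ j → 5 ≤ ‖p i - p j‖
  delta_pos : ∀ k, 0 < δ k
  interaction_summable : ∀ k, Summable (fun l : {l : ℕ // l ≠ k} => m l / ‖p k - p l‖)
  interaction_le : ∀ k, ∑' l : {l : ℕ // l ≠ k}, m l / ‖p k - p l‖ ≤ δ k
  metric : IsSmoothMetric g
  complete : IsCompleteMetric g
  scalarFlat : ∀ x, scalarCurvature g x = 0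
  outside : ∀ x, (∀ k, 2 < ‖x - lam • p k‖) →
    g x = (blFactor m (fun k => lam • p k) x) ^ 4 • (1 : Matrix (Fin 3) (Fin 3) ℝ)
  const_pos : 0 < C
  inside : ∀ k, ∀ x ∈ Metric.ball (lam • p k) 2, ∀ I : List (Fin 3), I.length ≤ 2 → ∀ i j,
    |iterPderiv I (fun y => g y i j - (1 : Matrix (Fin 3) (Fin 3) ℝ) i j) x| ≤ C * m k

/-- The integral `∫_{|x| = r} F dA` with respect to Euclidean surface measure, written on the unit
sphere; `volume.toSphere` is the surface measure of the unit sphere, of total mass `4π`. -/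
def sphereIntegral (r : ℝ) (F : E3 → ℝ) : ℝ :=
  r ^ 2 * ∫ ξ : Metric.sphere (0 : E3) 1, F (r • (ξ : E3)) ∂((volume : Measure E3).toSphere)

/-- The ADM flux `∫_{|x| = r} ∑_{a,b,j} gᵃᵇ (∂_b g_{aj} - ∂_j g_{ab}) (xʲ/|x|) dA`. -/
def admFlux (g : TensorField) (r : ℝ) : ℝ :=
  sphereIntegral r fun x => ∑ a, ∑ b, ∑ j, (g x)⁻¹ a b *
    (pderiv b (fun y => g y a j) x - pderiv j (fun y => g y a b) x) * (x j / ‖x‖)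

/-- `g` is asymptotically flat, in the Cartesian coordinates in which its flux integrals are
computed: `g_{ij} - δ_{ij} = O(|x|^{-τ})` and `∂ g_{ij} = O(|x|^{-τ-1})` for some `τ > 1/2`.
Definitions that in addition prescribe the decay of second derivatives, or integrability of the
scalar curvature, are more restrictive. -/
def IsAsymptoticallyFlat (g : TensorField) : Prop :=
  ∃ τ : ℝ, 1 / 2 < τ ∧ ∀ i j,
    ((fun x => g x i j - (1 : Matrix (Fin 3) (Fin 3) ℝ) i j) =O[cocompact E3]
      fun x => ‖x‖ ^ (-τ)) ∧
    ∀ l, (pderiv l fun x => g x i j) =O[cocompact E3] fun x => ‖x‖ ^ (-τ - 1)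

/-- `g` is bounded below by a positive multiple of the Euclidean metric, uniformly on `ℝ³`. -/
def IsUniformlyPositive (g : TensorField) : Prop :=
  ∃ κ : ℝ, 0 < κ ∧ ∀ x v : E3, κ * ‖v‖ ^ 2 ≤ ∑ i, ∑ j, g x i j * v i * v j

/-- With radii `ρ r`, the number of balls `B(c k, ρ r)` that meet the sphere `{|x| = r}` is bounded
uniformly in `r > 0`. -/
def BoundedlyManyMeet (c : ℕ → E3) (ρ : ℝ → ℝ) : Prop :=
  ∃ N : ℕ, ∀ r : ℝ, 0 < r →
    {k : ℕ | (Metric.ball (c k) (ρ r) ∩ Metric.sphere (0 : E3) r).Nonempty}.encard ≤ N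

end

/-! Off the balls of radius 2 about the centers c_k the metric is U⁴δ, and the flux integrand is -8
∂_r U / U. Replacing 1/|y| on |y| < 2 by a C² superharmonic profile (`newtonKernel`) gives a
potential `regFactor` defined everywhere and equal to U off the balls; its negative Laplacian is,
formally, a sum of nonnegative bumps of mass 2π m_k supported in the balls. The flux is then
compared with that of a globally defined vector field, to which the divergence theorem applies.

Errors are measured with ν(y) = (1 + |y|²)^(-1/2). The integral of ν(x - c)³ over |x| = r is bounded
uniformly in c and in r ≥ 1, and tends to 0 for fixed c. Hence an integrand dominated by ∑ w_l ν(x -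
c_l)³ with ∑ w_l finite has vanishing integral as r → ∞, wherever the centers lie
(`tendsto_sphereIntegral_of_abs_le_tsum`).

Finite mass M: by Gauss's law the flux of -8 ∇U tends to 16π M. Dividing by U costs at most a
multiple of (∑ m ν²)(∑ m ν) ≤ 2M ∑ m ν³, and the k-th ball costs a multiple of (m_k + δ_k) ν³; both
errors vanish in the limit. The finitely many balls where the metric might be far from Euclidean end
up inside the sphere. The limit 16π M is positive because the masses are.

Infinite mass: div(-8 ∇U / U) ≥ -8 ΔU / U, and U is bounded because ∑ m_l ν(x - c_l) ≤ ε₀ + 3 ∑ δ_k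
at every x. So the flux of -8 ∇ log U is at least a constant times the enclosed mass; this is proved
for finite partial sums, which are smooth enough, and passed to the limit. The true flux differs
only on the boundedly many balls meeting the sphere, each of which costs a bounded amount.

Asymptotic flatness: at distance 5/2 from c_k a first derivative of g bounds m_k up to a multiple of
δ_k. Decay faster than 1/|x|, with boundedly many centers in each unit shell, makes these
derivatives summable, so the total mass is finite. -/

/-! ### Polar coordinates and the divergence theorem on balls -/

/-- Integration in polar coordinates. -/
theorem integral_eq_integral_sphereIntegral {F : E3 → ℝ} (hF : Integrable F) :
    ∫ x, F x = ∫ r in Set.Ioi (0 : ℝ), sphereIntegral r F := by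
  have hm := (volume : Measure E3).measurePreserving_homeomorphUnitSphereProd
  have he := (homeomorphUnitSphereProd E3).measurableEmbedding
  have hsm : MeasurableSet ({0}ᶜ : Set E3) := (measurableSet_singleton 0).compl
  set G : Metric.sphere (0 : E3) 1 × Set.Ioi (0 : ℝ) → ℝ :=
    fun z => F ((z.2 : ℝ) • (z.1 : E3)) with hG
  have hcomp : G ∘ homeomorphUnitSphereProd E3 = F ∘ Subtype.val := by
    funext z
    have hz : ‖(z : E3)‖ ≠ 0 := norm_ne_zero_iff.2 z.2
    simp [hG, smul_smul, hz]
  have hGi : Integrable G ((volume : Measure E3).toSphere.prod (Measure.volumeIoiPow 2)) := by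
    have := hm.integrable_comp_emb he (g := G)
    rw [finrank_euclideanSpace, Fintype.card_fin] at this
    rw [← this, hcomp, ← integrableOn_iff_comap_subtypeVal hsm]
    exact hF.integrableOn
  calc ∫ x, F x = ∫ x : ({0}ᶜ : Set E3), F x ∂(volume.comap Subtype.val) := by
        rw [integral_subtype_comap hsm, restrict_compl_singleton]
    _ = ∫ z, G z ∂((volume : Measure E3).toSphere.prod (Measure.volumeIoiPow 2)) := by
        have := hm.integral_comp he G
        rw [finrank_euclideanSpace, Fintype.card_fin] at this
        rw [← this]
        exact integral_congr_ae (.of_forall fun z => (congrFun hcomp z).symm)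
    _ = ∫ r : Set.Ioi (0 : ℝ), ∫ ξ, G (ξ, r) ∂(volume : Measure E3).toSphere
          ∂(Measure.volumeIoiPow 2) := integral_prod_symm _ hGi
    _ = ∫ r in Set.Ioi (0 : ℝ), sphereIntegral r F := by
        simp only [Measure.volumeIoiPow, ENNReal.ofReal]
        rw [integral_withDensity_eq_integral_smul, integral_subtype_comap measurableSet_Ioi
          fun a : ℝ => Real.toNNReal (a ^ 2) • ∫ ξ : Metric.sphere (0 : E3) 1, F (a • (ξ : E3))
            ∂(volume : Measure E3).toSphere]
        · refine setIntegral_congr_fun measurableSet_Ioi fun r _ => ?_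
          simp only [sphereIntegral]
          rw [NNReal.smul_def, Real.coe_toNNReal _ (sq_nonneg r), smul_eq_mul]
        · exact (measurable_subtype_coe.pow_const _).real_toNNReal

theorem continuous_sphereIntegral_radial {F : ℝ → Metric.sphere (0 : E3) 1 → ℝ}
    (hF : Continuous F.uncurry) :
    Continuous fun r => r ^ 2 * ∫ ξ, F r ξ ∂(volume : Measure E3).toSphere := by
  have := continuous_parametric_integral_of_continuous (μ := (volume : Measure E3).toSphere)
    hF isCompact_univ
  simp only [Measure.restrict_univ] at this
  fun_prop

theorem continuous_sphereIntegral {F : E3 → ℝ} (hF : Continuous F) :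
    Continuous fun r => sphereIntegral r F :=
  continuous_sphereIntegral_radial (F := fun r ξ => F (r • (ξ : E3)))
    (by unfold Function.uncurry; fun_prop)

theorem integrable_sphere_of_continuous {F : E3 → ℝ} (hF : Continuous F) (r : ℝ) :
    Integrable (fun ξ : Metric.sphere (0 : E3) 1 => F (r • (ξ : E3)))
      (volume : Measure E3).toSphere := by
  have hc : Continuous fun ξ : Metric.sphere (0 : E3) 1 => F (r • (ξ : E3)) := by fun_prop
  exact hc.integrable_of_hasCompactSupport (HasCompactSupport.of_compactSpace _)

theorem setIntegral_ball_eq_intervalIntegral_sphereIntegral {F : E3 → ℝ} (hF : Continuous F)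
    {r : ℝ} (hr : 0 ≤ r) :
    ∫ x in Metric.ball (0 : E3) r, F x = ∫ s in (0 : ℝ)..r, sphereIntegral s F := by
  have hi : Integrable ((Metric.ball (0 : E3) r).indicator F) := by
    rw [integrable_indicator_iff Metric.isOpen_ball.measurableSet]
    exact (hF.continuousOn.integrableOn_compact (isCompact_closedBall (0 : E3) r)).mono_set
      Metric.ball_subset_closedBall
  rw [← integral_indicator Metric.isOpen_ball.measurableSet,
    integral_eq_integral_sphereIntegral hi, intervalIntegral.integral_of_le hr,
    integral_Ioc_eq_integral_Ioo, setIntegral_eq_of_subset_of_forall_sdiff_eq_zero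
      (s := Set.Ioo 0 r) measurableSet_Ioi Set.Ioo_subset_Ioi_self]
  · refine setIntegral_congr_fun measurableSet_Ioo fun s hs => ?_
    simp only [sphereIntegral]
    congr 2
    funext ξ
    rw [Set.indicator_of_mem]
    simp [norm_smul, abs_of_pos hs.1, hs.2]
  · intro s hs
    have hs0 : 0 < s := hs.1
    have hrs : r ≤ s := not_lt.1 fun h => hs.2 ⟨hs0, h⟩
    simp only [sphereIntegral]
    have : ∀ ξ : Metric.sphere (0 : E3) 1,
        (Metric.ball (0 : E3) r).indicator F (s • (ξ : E3)) = 0 := fun ξ => by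
      refine Set.indicator_of_notMem ?_ _
      simp [norm_smul, abs_of_pos hs0, hrs]
    simp [this]

theorem continuous_pderiv {f : E3 → ℝ} (hf : ContDiff ℝ 1 f) (i : Fin 3) :
    Continuous (pderiv i f) :=
  (hf.continuous_fderiv one_ne_zero).clm_apply continuous_const

theorem norm_smul_sphere {r : ℝ} (hr : 0 ≤ r) (ξ : Metric.sphere (0 : E3) 1) :
    ‖r • (ξ : E3)‖ = r := by
  simp [norm_smul, abs_of_nonneg hr]

theorem hasFDerivAt_norm_of_ne_zero {x : E3} (hx : x ≠ 0) :
    HasFDerivAt (fun y : E3 => ‖y‖) (‖x‖⁻¹ • innerSL ℝ x) x := by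
  have h1 := (hasStrictFDerivAt_norm_sq x).hasFDerivAt.sqrt (by simpa using hx)
  simp only [Real.sqrt_sq (norm_nonneg _)] at h1
  refine h1.congr_fderiv ?_
  rw [two_smul, ← two_smul ℝ, smul_smul]
  congr 1
  field_simp

/-- A radial cutoff `H ∘ ‖·‖` with `H' = g` and `g` supported away from the origin. -/
theorem hasFDerivAt_comp_norm {H g : ℝ → ℝ} (hH : ∀ s, HasDerivAt H (g s) s) {ε : ℝ} (hε : 0 < ε)
    (hg : ∀ s < ε, g s = 0) (x : E3) :
    HasFDerivAt (fun y : E3 => H ‖y‖) ((g ‖x‖ * ‖x‖⁻¹) • innerSL ℝ x) x := by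
  rcases eq_or_ne x 0 with rfl | hx
  -- The norm is not differentiable at the origin, but `g` vanishes below `ε`, so the cutoff is
  -- constant there.
  · have hconst : ∀ s < ε, H s = H 0 := by
      intro s hs
      have : ∀ t ∈ Set.Iio ε, HasDerivWithinAt H 0 (Set.Iio ε) t := fun t ht => by
        simpa [hg t ht] using (hH t).hasDerivWithinAt (s := Set.Iio ε)
      exact (convex_Iio ε).is_const_of_fderivWithin_eq_zero (𝕜 := ℝ)
        (fun t ht => (this t ht).differentiableWithinAt)
        (fun t ht => by
          have h2 := (this t ht).hasFDerivWithinAt.fderivWithin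
            (isOpen_Iio.uniqueDiffWithinAt ht)
          simpa using h2) hs hε
    have : (fun y : E3 => H ‖y‖) =ᶠ[𝓝 0] fun _ => H 0 := by
      filter_upwards [Metric.ball_mem_nhds (0 : E3) hε] with y hy
      exact hconst _ (by simpa using hy)
    rw [map_zero, smul_zero]
    exact (hasFDerivAt_const (H 0) (0 : E3)).congr_of_eventuallyEq this
  · have := (hH ‖x‖).comp_hasFDerivAt x (hasFDerivAt_norm_of_ne_zero hx)
    rwa [smul_smul] at this

theorem pderiv_comp_norm {H g : ℝ → ℝ} (hH : ∀ s, HasDerivAt H (g s) s) {ε : ℝ} (hε : 0 < ε)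
    (hg : ∀ s < ε, g s = 0) (i : Fin 3) (x : E3) :
    pderiv i (fun y : E3 => H ‖y‖) x = g ‖x‖ * (x i / ‖x‖) := by
  rw [pderiv, (hasFDerivAt_comp_norm hH hε hg x).fderiv]
  simp [EuclideanSpace.inner_single_right, div_eq_mul_inv]
  ring

theorem contDiff_comp_norm {H g : ℝ → ℝ} (hH : ∀ s, HasDerivAt H (g s) s) (hgc : Continuous g)
    {ε : ℝ} (hε : 0 < ε) (hg : ∀ s < ε, g s = 0) : ContDiff ℝ 1 (fun y : E3 => H ‖y‖) := by
  rw [contDiff_one_iff_fderiv]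
  refine ⟨fun x => (hasFDerivAt_comp_norm hH hε hg x).differentiableAt, ?_⟩
  have : fderiv ℝ (fun y : E3 => H ‖y‖) = fun x => (g ‖x‖ * ‖x‖⁻¹) • innerSL ℝ x :=
    funext fun x => (hasFDerivAt_comp_norm hH hε hg x).fderiv
  rw [this]
  suffices h : Continuous fun x : E3 => g ‖x‖ * ‖x‖⁻¹ from
    h.smul (innerSL ℝ (E := E3)).continuous
  rw [continuous_iff_continuousAt]
  intro x
  rcases eq_or_ne x 0 with rfl | hx
  · have : (fun x : E3 => g ‖x‖ * ‖x‖⁻¹) =ᶠ[𝓝 0] fun _ => 0 := by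
      filter_upwards [Metric.ball_mem_nhds (0 : E3) hε] with y hy
      rw [hg _ (by simpa using hy), zero_mul]
    exact continuousAt_const.congr this.symm
  · exact (hgc.continuousAt.comp continuous_norm.continuousAt).mul
      (continuous_norm.continuousAt.inv₀ (norm_ne_zero_iff.2 hx))

/-- Integration by parts against a radial cutoff. -/
theorem integral_comp_norm_mul_div {X : Fin 3 → E3 → ℝ} (hX : ∀ j, ContDiff ℝ 1 (X j))
    {H g : ℝ → ℝ} (hH : ∀ s, HasDerivAt H (g s) s) (hgc : Continuous g) {ε : ℝ} (hε : 0 < ε)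
    (hg : ∀ s < ε, g s = 0) {R : ℝ} (hR : ∀ s, R ≤ s → H s = 0) (hgR : ∀ s, R ≤ s → g s = 0) :
    Integrable (fun x => H ‖x‖ * ∑ j, pderiv j (X j) x) ∧
    Integrable (fun x => g ‖x‖ * ∑ j, X j x * (x j / ‖x‖)) ∧
    ∫ x, H ‖x‖ * ∑ j, pderiv j (X j) x = -∫ x, g ‖x‖ * ∑ j, X j x * (x j / ‖x‖) := by
  have hc1 : ContDiff ℝ 1 (fun y : E3 => H ‖y‖) := contDiff_comp_norm hH hgc hε hg
  have hsupp : HasCompactSupport (fun y : E3 => H ‖y‖) :=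
    HasCompactSupport.intro (isCompact_closedBall (0 : E3) R) fun x hx => hR _ <| by
      simpa using (not_le.1 (by simpa using hx) : R < ‖x‖).le
  have hpd : ∀ j, Continuous (pderiv j fun y : E3 => H ‖y‖) := continuous_pderiv hc1
  have hps : ∀ j, HasCompactSupport (pderiv j fun y : E3 => H ‖y‖) := fun j =>
    HasCompactSupport.intro (isCompact_closedBall (0 : E3) R) fun x hx => by
      rw [pderiv_comp_norm hH hε hg, hgR, zero_mul]
      simpa using (not_le.1 (by simpa using hx) : R < ‖x‖).le
  have i1 : ∀ j, Integrable fun x => H ‖x‖ * pderiv j (X j) x := fun j =>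
    (hc1.continuous.mul (continuous_pderiv (hX j) j)).integrable_of_hasCompactSupport
      hsupp.mul_right
  have i2 : ∀ j, Integrable fun x => pderiv j (fun y : E3 => H ‖y‖) x * X j x := fun j =>
    ((hpd j).mul (hX j).continuous).integrable_of_hasCompactSupport (hps j).mul_right
  have i3 : ∀ j, Integrable fun x => H ‖x‖ * X j x := fun j =>
    (hc1.continuous.mul (hX j).continuous).integrable_of_hasCompactSupport hsupp.mul_right
  have parts : ∀ j, ∫ x, H ‖x‖ * pderiv j (X j) x =
      -∫ x, pderiv j (fun y : E3 => H ‖y‖) x * X j x := fun j =>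
    integral_mul_fderiv_eq_neg_fderiv_mul_of_integrable (i2 j) (i1 j) (i3 j)
      (fun x _ => (hc1.differentiable one_ne_zero) x)
      (fun x _ => ((hX j).differentiable one_ne_zero) x)
  have e2 : (fun x : E3 => g ‖x‖ * ∑ j, X j x * (x j / ‖x‖)) =
      fun x => ∑ j, pderiv j (fun y : E3 => H ‖y‖) x * X j x := by
    funext x
    rw [Finset.mul_sum]
    refine Finset.sum_congr rfl fun j _ => ?_
    rw [pderiv_comp_norm hH hε hg]
    ring
  rw [e2]
  simp only [Finset.mul_sum]
  refine ⟨integrable_finsetSum _ fun j _ => i1 j, integrable_finsetSum _ fun j _ => i2 j, ?_⟩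
  rw [integral_finsetSum _ fun j _ => i1 j, integral_finsetSum _ fun j _ => i2 j,
    ← Finset.sum_neg_distrib]
  exact Finset.sum_congr rfl fun j _ => parts j

/-- The flux of a vector field through the centered sphere of radius `r`. -/
noncomputable def sphereFlux (X : Fin 3 → E3 → ℝ) (r : ℝ) : ℝ :=
  sphereIntegral r fun x => ∑ j, X j x * (x j / ‖x‖)

theorem sphereFlux_eq {X : Fin 3 → E3 → ℝ} {r : ℝ} (hr : 0 < r) :
    sphereFlux X r = r ^ 2 * ∫ ξ : Metric.sphere (0 : E3) 1,
      ∑ j, X j (r • (ξ : E3)) * (ξ : E3) j ∂(volume : Measure E3).toSphere := by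
  simp only [sphereFlux, sphereIntegral, norm_smul_sphere hr.le]
  congr 2
  funext ξ
  refine Finset.sum_congr rfl fun j _ => ?_
  simp
  left
  field_simp

/-- The divergence theorem on a centered ball. -/
theorem sphereFlux_eq_integral_ball {X : Fin 3 → E3 → ℝ} (hX : ∀ j, ContDiff ℝ 1 (X j)) {r : ℝ}
    (hr : 0 < r) :
    sphereFlux X r = ∫ x in Metric.ball (0 : E3) r, ∑ j, pderiv j (X j) x := by
  have hdiv : Continuous fun x => ∑ j, pderiv j (X j) x :=
    continuous_finsetSum _ fun j _ => continuous_pderiv (hX j) j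
  set ψ : ℝ → ℝ := fun s => sphereIntegral s fun x => ∑ j, pderiv j (X j) x with hψ
  have hψc : Continuous ψ := continuous_sphereIntegral hdiv
  -- With `ξ j` in place of `x j / ‖x‖` the flux extends continuously to all real `s`; the two agree
  -- for `s > 0`.
  set φ : ℝ → ℝ := fun s => s ^ 2 * ∫ ξ : Metric.sphere (0 : E3) 1,
      ∑ j, X j (s • (ξ : E3)) * (ξ : E3) j ∂(volume : Measure E3).toSphere with hφ
  have hφc : Continuous φ := by
    refine continuous_sphereIntegral_radial
      (F := fun s ξ => ∑ j, X j (s • (ξ : E3)) * (ξ : E3) j) ?_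
    unfold Function.uncurry
    have := fun j => (hX j).continuous
    fun_prop
  set Φ : ℝ → ℝ := fun t => ∫ s in (0 : ℝ)..t, ψ s with hΦ
  have hΦd : ∀ t, HasDerivAt Φ (ψ t) t := fun t => hψc.integral_hasStrictDerivAt 0 t |>.hasDerivAt
  have hΦc : Continuous Φ := continuous_iff_continuousAt.2 fun t => (hΦd t).continuousAt
  -- The flux and the volume integral of the divergence agree in the weak sense on the half-line:
  -- with H a primitive of `g`, integrate H(|x|) div X by parts on ℝ³, and H ψ by parts on the
  -- half-line.
  have key : ∀ g : ℝ → ℝ, ContDiff ℝ ∞ g → HasCompactSupport g → tsupport g ⊆ Set.Ioi 0 →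
      ∫ s, g s • (φ s - Φ s) = 0 := by
    intro g hgC hgs hgt
    have hgc := hgC.continuous
    obtain ⟨ε, hε, hgε⟩ : ∃ ε > 0, ∀ s < ε, g s = 0 := by
      rcases (tsupport g).eq_empty_or_nonempty with he | hne
      · exact ⟨1, one_pos, fun s _ => image_eq_zero_of_notMem_tsupport (by simp [he])⟩
      · obtain ⟨a, ha, hmin⟩ := hgs.isCompact.exists_isMinOn hne continuousOn_id
        exact ⟨a, hgt ha, fun s hs => image_eq_zero_of_notMem_tsupport fun h =>
          absurd (hmin h) (not_le.2 hs)⟩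
    obtain ⟨R, hR0, hgR⟩ : ∃ R > 0, ∀ s, R ≤ s → g s = 0 := by
      obtain ⟨R, hR⟩ := hgs.isCompact.isBounded.subset_ball 0
      refine ⟨max R 1, by positivity, fun s hs => image_eq_zero_of_notMem_tsupport fun h => ?_⟩
      have h1 := hR h
      rw [Metric.mem_ball, dist_zero_right, Real.norm_eq_abs] at h1
      exact absurd ((le_abs_self s).trans_lt h1) (not_lt.2 ((le_max_left _ _).trans hs))
    -- The base point `R` lies beyond the support of `g`, so that H(|x|) has compact support.
    set H : ℝ → ℝ := fun t => ∫ s in R..t, g s with hHdef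
    have hH : ∀ t, HasDerivAt H (g t) t := fun t =>
      hgc.integral_hasStrictDerivAt R t |>.hasDerivAt
    have hHR : ∀ t, R ≤ t → H t = 0 := fun t ht => by
      rw [hHdef]
      refine intervalIntegral.integral_zero_ae (.of_forall fun s hs => ?_)
      rw [Set.uIoc_of_le ht] at hs
      exact hgR s hs.1.le
    obtain ⟨i1, i2, e⟩ := integral_comp_norm_mul_div hX hH hgc hε hgε hHR hgR
    rw [integral_eq_integral_sphereIntegral i1, integral_eq_integral_sphereIntegral i2] at e
    have restrict_eq : ∀ f : ℝ → ℝ, (∀ s, R ≤ s → f s = 0) →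
        ∫ s in Set.Ioi (0 : ℝ), f s = ∫ s in (0 : ℝ)..R, f s := fun f hf => by
      rw [intervalIntegral.integral_of_le hR0.le]
      exact setIntegral_eq_of_subset_of_forall_sdiff_eq_zero measurableSet_Ioi
        Set.Ioc_subset_Ioi_self fun s hs => hf s (not_lt.1 fun h => hs.2 ⟨hs.1, h.le⟩)
    have e1 : ∫ s in Set.Ioi (0 : ℝ),
        sphereIntegral s (fun x => H ‖x‖ * ∑ j, pderiv j (X j) x) =
        ∫ s in (0 : ℝ)..R, H s * ψ s := by
      rw [← restrict_eq _ fun s hs => by rw [hHR s hs, zero_mul]]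
      refine setIntegral_congr_fun measurableSet_Ioi fun s hs => ?_
      simp only [sphereIntegral, norm_smul_sphere (le_of_lt hs), hψ, integral_const_mul]
      ring
    have e2 : ∫ s in Set.Ioi (0 : ℝ),
        sphereIntegral s (fun x => g ‖x‖ * ∑ j, X j x * (x j / ‖x‖)) =
        ∫ s in (0 : ℝ)..R, g s * φ s := by
      rw [← restrict_eq _ fun s hs => by rw [hgR s hs, zero_mul]]
      refine setIntegral_congr_fun measurableSet_Ioi fun s hs => ?_
      have := sphereFlux_eq (X := X) hs
      simp only [sphereFlux, sphereIntegral, norm_smul_sphere (le_of_lt hs)] at this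
      simp only [sphereIntegral, norm_smul_sphere (le_of_lt hs), hφ, integral_const_mul, ← this]
      ring
    have e3 := intervalIntegral.integral_mul_deriv_eq_deriv_mul (a := 0) (b := R)
      (fun t _ => hH t) (fun t _ => hΦd t) (hgc.intervalIntegrable _ _)
      (hψc.intervalIntegrable _ _)
    have hΦ0 : Φ 0 = 0 := by simp [hΦ]
    rw [e1, e2, e3, hHR R le_rfl, hΦ0] at e
    have e4 : ∫ s, g s • (φ s - Φ s) = ∫ s in (0 : ℝ)..R, (g s * φ s - g s * Φ s) := by
      rw [← restrict_eq _ fun s hs => by rw [hgR s hs]; ring,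
        ← setIntegral_eq_integral_of_forall_compl_eq_zero (s := Set.Ioi (0 : ℝ))]
      · simp only [smul_eq_mul, mul_sub]
      · intro s hs
        rw [hgε s ((not_lt.1 hs).trans_lt hε), zero_smul]
    have j1 : IntervalIntegrable (fun s => g s * φ s) volume 0 R :=
      (hgc.mul hφc).intervalIntegrable _ _
    have j2 : IntervalIntegrable (fun s => g s * Φ s) volume 0 R :=
      (hgc.mul hΦc).intervalIntegrable _ _
    rw [e4, intervalIntegral.integral_sub j1 j2]
    linarith
  -- Weak equality gives equality for almost every radius; continuity upgrades it to every radius.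
  have hae := isOpen_Ioi.ae_eq_zero_of_integral_contDiff_smul_eq_zero
    ((hφc.sub hΦc).locallyIntegrable.locallyIntegrableOn (Set.Ioi (0 : ℝ))) key
  have heq : Set.EqOn (fun s => φ s - Φ s) 0 (Set.Ioi 0) :=
    Measure.eqOn_open_of_ae_eq ((ae_restrict_iff' measurableSet_Ioi).2 hae) isOpen_Ioi
      (hφc.sub hΦc).continuousOn continuousOn_const
  rw [sphereFlux_eq hr, setIntegral_ball_eq_intervalIntegral_sphereIntegral hdiv hr.le]
  exact sub_eq_zero.1 (heq hr)

/-! ### The Japanese bracket and its integrals over large spheres -/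

/-- The Japanese bracket to the power `-1`. -/
noncomputable def nu (y : E3) : ℝ := (√(1 + ‖y‖ ^ 2))⁻¹

theorem nu_pos (y : E3) : 0 < nu y := by unfold nu; positivity

theorem nu_sq (y : E3) : nu y ^ 2 = (1 + ‖y‖ ^ 2)⁻¹ := by
  rw [nu, inv_pow, Real.sq_sqrt (by positivity)]

theorem nu_le_one (y : E3) : nu y ≤ 1 := by
  refine inv_le_one_of_one_le₀ (Real.one_le_sqrt.2 ?_)
  linarith [sq_nonneg ‖y‖]

theorem nu_mul_norm_le_one (y : E3) : nu y * ‖y‖ ≤ 1 := by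
  rw [nu, inv_mul_le_one₀ (by positivity)]
  exact Real.le_sqrt_of_sq_le (by linarith)

theorem nu_le_inv_norm {y : E3} (hy : y ≠ 0) : nu y ≤ ‖y‖⁻¹ := by
  rw [← one_div, le_div_iff₀ (norm_pos_iff.2 hy)]
  exact nu_mul_norm_le_one y

/-- Peetre's inequality. -/
theorem nu_le_mul_nu (a b : E3) : nu a ≤ √(2 * (1 + ‖a - b‖ ^ 2)) * nu b := by
  rw [nu, nu, ← div_eq_mul_inv, ← one_div, div_le_div_iff₀ (by positivity) (by positivity),
    one_mul, ← Real.sqrt_mul (by positivity)]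
  apply Real.sqrt_le_sqrt
  have h : ‖b‖ ≤ ‖a‖ + ‖a - b‖ := by
    have := norm_sub_le a (a - b)
    simpa using this
  have h2 : ‖b‖ ^ 2 ≤ (‖a‖ + ‖a - b‖) ^ 2 := by gcongr
  nlinarith [sq_nonneg (‖a‖ - ‖a - b‖), sq_nonneg (‖a‖ * ‖a - b‖), sq_nonneg ‖a‖]

theorem continuous_nu : Continuous nu := by
  unfold nu
  refine Continuous.inv₀ (by fun_prop) fun y => ?_
  positivity

theorem hasFDerivAt_nu (y : E3) : HasFDerivAt nu (-(nu y ^ 3) • innerSL ℝ y) y := by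
  have hpos : 0 < 1 + ‖y‖ ^ 2 := by positivity
  have h1 := ((hasStrictFDerivAt_norm_sq y).hasFDerivAt.const_add 1).sqrt hpos.ne'
  have h2 := (hasDerivAt_inv (Real.sqrt_pos.2 hpos).ne').comp_hasFDerivAt y h1
  refine h2.congr_fderiv ?_
  rw [two_smul, ← two_smul ℝ, smul_smul, smul_smul]
  congr 1
  unfold nu
  field_simp

theorem contDiff_nu : ContDiff ℝ 1 nu := by
  unfold nu
  refine ContDiff.inv (ContDiff.sqrt (contDiff_const.add (contDiff_norm_sq ℝ)) fun y => ?_)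
    fun y => ?_ <;> positivity

theorem pderiv_of_hasFDerivAt {f : E3 → ℝ} {x : E3} {f' : E3 →L[ℝ] ℝ} (h : HasFDerivAt f f' x)
    (i : Fin 3) : pderiv i f x = f' (EuclideanSpace.single i 1) := by
  rw [pderiv, h.fderiv]

theorem sum_mul_self_eq_norm_sq (x : E3) : ∑ j, x j * x j = ‖x‖ ^ 2 := by
  rw [EuclideanSpace.real_norm_sq_eq]
  exact Finset.sum_congr rfl fun j _ => (sq _).symm

theorem sum_mul_eq_inner (x y : E3) : ∑ j, x j * y j = inner ℝ x y := by
  simp [PiLp.inner_apply, mul_comm]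

theorem abs_sum_mul_le (x y : E3) : |∑ j, x j * y j| ≤ ‖x‖ * ‖y‖ := by
  rw [sum_mul_eq_inner]
  exact abs_real_inner_le_norm x y

theorem abs_sphereIntegral_le {r : ℝ} {H B : E3 → ℝ}
    (hB : Integrable (fun ξ : Metric.sphere (0 : E3) 1 => B (r • (ξ : E3)))
      (volume : Measure E3).toSphere) (hr : 0 ≤ r) (h : ∀ x, ‖x‖ = r → |H x| ≤ B x) :
    |sphereIntegral r H| ≤ sphereIntegral r B := by
  rw [sphereIntegral, sphereIntegral, abs_mul, abs_of_nonneg (sq_nonneg r)]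
  refine mul_le_mul_of_nonneg_left ?_ (sq_nonneg r)
  exact norm_integral_le_of_norm_le (f := fun ξ : Metric.sphere (0 : E3) 1 => H (r • (ξ : E3))) hB
    (.of_forall fun ξ => h _ (norm_smul_sphere hr ξ))

theorem sphereIntegral_congr {r : ℝ} (hr : 0 ≤ r) {F G : E3 → ℝ} (h : ∀ x, ‖x‖ = r → F x = G x) :
    sphereIntegral r F = sphereIntegral r G := by
  simp only [sphereIntegral, h _ (norm_smul_sphere hr _)]

theorem sphereIntegral_const_mul (r a : ℝ) (F : E3 → ℝ) :
    sphereIntegral r (fun x => a * F x) = a * sphereIntegral r F := by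
  rw [sphereIntegral, integral_const_mul, sphereIntegral]
  ring

theorem toSphere_real_univ :
    (volume : Measure E3).toSphere.real Set.univ = 4 * Real.pi := by
  rw [Measure.toSphere_real_apply_univ, Measure.real, EuclideanSpace.volume_ball_fin_three]
  simp [ENNReal.toReal_ofReal (show 0 ≤ Real.pi * 4 / 3 by positivity)]
  ring

theorem sphereIntegral_const (r a : ℝ) : sphereIntegral r (fun _ => a) = 4 * Real.pi * r ^ 2 * a := by
  rw [sphereIntegral, integral_const, toSphere_real_univ, smul_eq_mul]
  ring

theorem volume_real_ball {r : ℝ} (hr : 0 ≤ r) :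
    volume.real (Metric.ball (0 : E3) r) = 4 * Real.pi / 3 * r ^ 3 := by
  rw [Measure.real, EuclideanSpace.volume_ball_fin_three, ENNReal.toReal_mul, ENNReal.toReal_pow,
    ENNReal.toReal_ofReal hr, ENNReal.toReal_ofReal (by positivity)]
  ring

theorem integrable_sphere_of_continuousOn {F : E3 → ℝ} (hF : ContinuousOn F {0}ᶜ) {r : ℝ}
    (hr : 0 < r) : Integrable (fun ξ : Metric.sphere (0 : E3) 1 => F (r • (ξ : E3)))
      (volume : Measure E3).toSphere := by
  have hc : Continuous fun ξ : Metric.sphere (0 : E3) 1 => F (r • (ξ : E3)) := by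
    refine hF.comp_continuous (by fun_prop) fun ξ => ?_
    rw [Set.mem_compl_singleton_iff, ← norm_ne_zero_iff, norm_smul_sphere hr.le]
    exact hr.ne'
  exact hc.integrable_of_hasCompactSupport (HasCompactSupport.of_compactSpace _)

theorem sphereIntegral_tsum {F : ℕ → E3 → ℝ} {w : ℕ → ℝ} (hF : ∀ l, ContinuousOn (F l) {0}ᶜ)
    (hw : Summable w) (hb : ∀ l x, |F l x| ≤ w l) {r : ℝ} (hr : 0 < r) :
    sphereIntegral r (fun x => ∑' l, F l x) = ∑' l, sphereIntegral r (F l) := by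
  have hint := fun l => integrable_sphere_of_continuousOn (hF l) hr
  rw [sphereIntegral, ← integral_tsum_of_summable_integral_norm hint, ← tsum_mul_left]
  · rfl
  · refine (hw.mul_right (4 * Real.pi)).of_nonneg_of_le
      (fun l => integral_nonneg fun _ => norm_nonneg _) fun l => ?_
    have := integral_mono (hint l).norm (integrable_const (w l)) fun ξ => hb l (r • (ξ : E3))
    rwa [integral_const, toSphere_real_univ, smul_eq_mul, mul_comm] at this

theorem integrable_nu_pow_four : Integrable fun y : E3 => nu y ^ 4 := by
  have := integrable_rpow_neg_one_add_norm_sq (E := E3) (μ := volume) (r := 4)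
    (by simp; norm_num)
  refine this.congr (.of_forall fun y => ?_)
  have h : nu y ^ 4 = (nu y ^ 2) ^ 2 := by ring
  simp only [h, nu_sq]
  rw [show (-4 / 2 : ℝ) = -(2 : ℕ) by norm_num, Real.rpow_neg (by positivity), Real.rpow_natCast,
    inv_pow]

/-- A uniform bound for the integrals of `nu (· - c) ^ 3` over large centered spheres. -/
noncomputable def nuSphereBound : ℝ := 6 * (∫ y : E3, nu y ^ 4) + 4 * Real.pi

theorem sphereIntegral_nu_pow_three_nonneg (c : E3) (r : ℝ) :
    0 ≤ sphereIntegral r fun x => nu (x - c) ^ 3 :=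
  mul_nonneg (sq_nonneg r) (integral_nonneg fun _ => (pow_pos (nu_pos _) 3).le)

theorem continuous_nu_sub (c : E3) : Continuous fun x => nu (x - c) :=
  continuous_nu.comp (by fun_prop)

/-- Apply the divergence theorem to x ν(x - c)³, whose flux through |x| = r is r times the integral
in question. Its divergence is at most 6r ν⁴ + 3/r³; since ν⁴ is integrable on ℝ³, dividing by r ≥ 1
leaves a bound independent of c and r. -/
theorem sphereIntegral_nu_pow_three_le (c : E3) {r : ℝ} (hr : 1 ≤ r) :
    sphereIntegral r (fun x => nu (x - c) ^ 3) ≤ nuSphereBound := by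
  have hr0 : 0 < r := by linarith
  set X : Fin 3 → E3 → ℝ := fun j x => x j * nu (x - c) ^ 3 with hX
  have hXc : ∀ j, ContDiff ℝ 1 (X j) := fun j =>
    (contDiff_piLp_apply 2 ).mul ((contDiff_nu.comp (contDiff_id.sub contDiff_const)).pow 3)
  have hflux : sphereFlux X r = r * sphereIntegral r (fun x => nu (x - c) ^ 3) := by
    rw [← sphereIntegral_const_mul, sphereFlux]
    refine sphereIntegral_congr hr0.le fun x hn => ?_
    have : ∑ j, X j x * (x j / ‖x‖) = nu (x - c) ^ 3 * (∑ j, x j * x j) / ‖x‖ := by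
      rw [Finset.mul_sum, Finset.sum_div]
      exact Finset.sum_congr rfl fun j _ => by simp only [hX]; ring
    rw [this, sum_mul_self_eq_norm_sq, hn]
    field_simp
  have hderiv : ∀ j x, pderiv j (X j) x =
      nu (x - c) ^ 3 - 3 * nu (x - c) ^ 5 * (x j * (x - c) j) := by
    intro j x
    have h1 : HasFDerivAt (fun y : E3 => nu (y - c)) (-(nu (x - c) ^ 3) • innerSL ℝ (x - c)) x :=
      (hasFDerivAt_nu (x - c)).comp x (f := fun y : E3 => y - c)
        ((hasFDerivAt_id x).sub_const c)
    have h2 : HasFDerivAt (fun y : E3 => y j) (EuclideanSpace.proj j : E3 →L[ℝ] ℝ) x :=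
      (EuclideanSpace.proj j : E3 →L[ℝ] ℝ).hasFDerivAt
    rw [pderiv_of_hasFDerivAt (f := X j) (h2.mul (h1.pow 3))]
    simp [EuclideanSpace.inner_single_right]
    ring
  have hbound : ∀ x ∈ Metric.ball (0 : E3) r,
      ∑ j, pderiv j (X j) x ≤ 6 * r * nu (x - c) ^ 4 + 3 / r ^ 3 := by
    intro x hx
    have hxr : ‖x‖ ≤ r := by simpa using (Metric.mem_ball.1 hx).le
    set n := nu (x - c) with hn
    have hn0 : 0 < n := nu_pos _
    have e : ∑ j, pderiv j (X j) x = 3 * n ^ 3 - 3 * n ^ 5 * ∑ j, x j * (x - c) j := by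
      simp only [hderiv, Finset.sum_sub_distrib, Finset.mul_sum]
      simp [hn]
    have h1 : -(r * ‖x - c‖) ≤ ∑ j, x j * (x - c) j :=
      (neg_le_neg (by gcongr)).trans (neg_le_of_abs_le (abs_sum_mul_le x (x - c)))
    have h2 : n ^ 5 * (r * ‖x - c‖) ≤ r * n ^ 4 := by
      have := nu_mul_norm_le_one (x - c)
      rw [← hn] at this
      calc n ^ 5 * (r * ‖x - c‖) = r * n ^ 4 * (n * ‖x - c‖) := by ring
        _ ≤ r * n ^ 4 * 1 := by gcongr
        _ = _ := mul_one _
    -- One of the two terms suffices, according to whether n ≥ 1/r or n ≤ 1/r.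
    have h3 : n ^ 3 ≤ r * n ^ 4 + 1 / r ^ 3 := by
      rcases le_total 1 (r * n) with h | h
      · have : n ^ 3 * 1 ≤ n ^ 3 * (r * n) := by gcongr
        have h5 : 0 < 1 / r ^ 3 := by positivity
        nlinarith
      · have : (r * n) ^ 3 ≤ 1 := pow_le_one₀ (by positivity) h
        have h4 : n ^ 3 ≤ 1 / r ^ 3 := by
          rw [le_div_iff₀ (by positivity)]
          nlinarith
        have h5 : 0 < r * n ^ 4 := by positivity
        linarith
    have h4 : n ^ 5 * -(r * ‖x - c‖) ≤ n ^ 5 * ∑ j, x j * (x - c) j := by gcongr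
    rw [e]
    have : 3 / r ^ 3 = 3 * (1 / r ^ 3) := by ring
    nlinarith
  have hJ : Integrable fun x : E3 => nu (x - c) ^ 4 := integrable_nu_pow_four.comp_sub_right c
  have hJle : ∫ x in Metric.ball (0 : E3) r, nu (x - c) ^ 4 ≤ ∫ y : E3, nu y ^ 4 := by
    rw [← integral_sub_right_eq_self (fun y : E3 => nu y ^ 4) c]
    exact setIntegral_le_integral hJ (.of_forall fun x => (pow_pos (nu_pos _) 4).le)
  have hdivc : Continuous fun x => ∑ j, pderiv j (X j) x :=
    continuous_finsetSum _ fun j _ => continuous_pderiv (hXc j) j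
  have hle : sphereFlux X r ≤ 6 * r * (∫ y : E3, nu y ^ 4) + 4 * Real.pi := by
    rw [sphereFlux_eq_integral_ball hXc hr0]
    have hci : IntegrableOn (fun _ : E3 => 3 / r ^ 3) (Metric.ball (0 : E3) r) :=
      integrableOn_const (measure_ball_lt_top.ne)
    have hni : IntegrableOn (fun x : E3 => 6 * r * nu (x - c) ^ 4) (Metric.ball (0 : E3) r) :=
      (hJ.const_mul _).integrableOn
    calc ∫ x in Metric.ball (0 : E3) r, ∑ j, pderiv j (X j) x
        ≤ ∫ x in Metric.ball (0 : E3) r, (6 * r * nu (x - c) ^ 4 + 3 / r ^ 3) :=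
          setIntegral_mono_on ((hdivc.continuousOn.integrableOn_compact
            (isCompact_closedBall (0 : E3) r)).mono_set Metric.ball_subset_closedBall)
            (hni.add hci) Metric.isOpen_ball.measurableSet hbound
      _ = 6 * r * (∫ x in Metric.ball (0 : E3) r, nu (x - c) ^ 4) + 4 * Real.pi := by
          rw [integral_add hni hci, integral_const_mul, setIntegral_const, volume_real_ball hr0.le,
            smul_eq_mul]
          field_simp
      _ ≤ _ := by gcongr
  rw [hflux] at hle
  have hπ := Real.pi_pos
  have : r * sphereIntegral r (fun x => nu (x - c) ^ 3) ≤ r * nuSphereBound := by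
    rw [nuSphereBound]
    nlinarith
  exact le_of_mul_le_mul_left this hr0

/-- Once r ≥ 2|c| the integrand is at most (2/r)³ on a sphere of area 4πr². -/
theorem tendsto_sphereIntegral_nu_pow_three (c : E3) :
    Tendsto (fun r => sphereIntegral r fun x => nu (x - c) ^ 3) atTop (𝓝 0) := by
  refine squeeze_zero' (.of_forall fun r => sphereIntegral_nu_pow_three_nonneg c r)
    (g := fun r => 32 * Real.pi / r) ?_ (tendsto_const_nhds.div_atTop tendsto_id)
  filter_upwards [eventually_ge_atTop (2 * ‖c‖), eventually_gt_atTop 0] with r hr hr0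
  have := abs_sphereIntegral_le (r := r) (H := fun x => nu (x - c) ^ 3)
    (B := fun _ => (2 / r) ^ 3) (integrable_const _) hr0.le (fun x hx => ?_)
  · refine (le_abs_self _).trans (this.trans (le_of_eq ?_))
    rw [sphereIntegral_const]
    field_simp
    norm_num
  · rw [abs_of_pos (pow_pos (nu_pos _) 3)]
    have h1 : r / 2 ≤ ‖x - c‖ := by
      have := norm_sub_norm_le x c
      linarith
    have h2 : x - c ≠ 0 := norm_pos_iff.1 (lt_of_lt_of_le (by positivity) h1)
    have h3 : nu (x - c) ≤ 2 / r := (nu_le_inv_norm h2).trans <| by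
      rw [← inv_div]
      gcongr
    exact pow_le_pow_left₀ (nu_pos _).le h3 3

theorem summable_mul_nu_pow_three {w : ℕ → ℝ} (hw : Summable w) (hw0 : ∀ l, 0 ≤ w l)
    (c : ℕ → E3) (x : E3) : Summable fun l => w l * nu (x - c l) ^ 3 :=
  hw.of_nonneg_of_le (fun l => mul_nonneg (hw0 l) (pow_pos (nu_pos _) 3).le) fun l =>
    mul_le_of_le_one_right (hw0 l) (pow_le_one₀ (nu_pos _).le (nu_le_one _))

/-- This disposes of all errors in the finite-mass case. Each term tends to 0 and is at most w_l
times `nuSphereBound` for r ≥ 1, so dominated convergence for series applies without any hypothesis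
on the position of the centers. -/
theorem tendsto_sphereIntegral_of_abs_le_tsum {w : ℕ → ℝ} (hw : Summable w) (hw0 : ∀ l, 0 ≤ w l)
    (c : ℕ → E3) {H : ℝ → E3 → ℝ}
    (hH : ∀ᶠ r in atTop, ∀ x, ‖x‖ = r → |H r x| ≤ ∑' l, w l * nu (x - c l) ^ 3) :
    Tendsto (fun r => sphereIntegral r (H r)) atTop (𝓝 0) := by
  have hterm : ∀ l, Tendsto (fun r => w l * sphereIntegral r fun x => nu (x - c l) ^ 3) atTop
      (𝓝 0) := fun l => by
    simpa using (tendsto_sphereIntegral_nu_pow_three (c l)).const_mul (w l)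
  have hsum : Tendsto (fun r => ∑' l, w l * sphereIntegral r fun x => nu (x - c l) ^ 3) atTop
      (𝓝 0) := by
    have := tendsto_tsum_of_dominated_convergence (hw.mul_right nuSphereBound) hterm (by
      filter_upwards [eventually_ge_atTop 1] with r hr l
      rw [norm_mul, Real.norm_of_nonneg (hw0 l),
        Real.norm_of_nonneg (sphereIntegral_nu_pow_three_nonneg _ _)]
      exact mul_le_mul_of_nonneg_left (sphereIntegral_nu_pow_three_le (c l) hr) (hw0 l))
    simpa using this
  refine squeeze_zero_norm' ?_ hsum
  filter_upwards [hH, eventually_gt_atTop 0] with r hr hr0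
  have hcont : Continuous fun x => ∑' l, w l * nu (x - c l) ^ 3 :=
    continuous_tsum (fun l => continuous_const.mul ((continuous_nu_sub (c l)).pow 3)) hw
      fun l x => by
        rw [Real.norm_of_nonneg (mul_nonneg (hw0 l) (pow_pos (nu_pos _) 3).le)]
        exact mul_le_of_le_one_right (hw0 l) (pow_le_one₀ (nu_pos _).le (nu_le_one _))
  refine (abs_sphereIntegral_le (integrable_sphere_of_continuous hcont r) hr0.le hr).trans
    (le_of_eq ?_)
  rw [sphereIntegral_tsum (F := fun l x => w l * nu (x - c l) ^ 3) (fun l => (continuous_const.mul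
    ((continuous_nu_sub (c l)).pow 3)).continuousOn) hw (fun l x => ?_) hr0]
  · exact tsum_congr fun l => sphereIntegral_const_mul r _ _
  · rw [abs_of_nonneg (mul_nonneg (hw0 l) (pow_pos (nu_pos _) 3).le)]
    exact mul_le_of_le_one_right (hw0 l) (pow_le_one₀ (nu_pos _).le (nu_le_one _))

/-! ### The regularized Newton kernel -/

/-- Gluing two functions at a point where their values and derivatives agree. -/
theorem hasDerivAt_ite_le {f g f' g' : ℝ → ℝ} {c : ℝ} (hf : ∀ s ≤ c, HasDerivAt f (f' s) s)
    (hg : ∀ s, c ≤ s → HasDerivAt g (g' s) s) (h : f c = g c) (h' : f' c = g' c) (s : ℝ) :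
    HasDerivAt (fun s => if s ≤ c then f s else g s) (if s ≤ c then f' s else g' s) s := by
  rcases lt_trichotomy s c with hs | rfl | hs
  · rw [if_pos hs.le]
    refine (hf s hs.le).congr_of_eventuallyEq ?_
    filter_upwards [Iio_mem_nhds hs] with t ht
    exact if_pos (le_of_lt ht)
  · rw [if_pos le_rfl, ← hasDerivWithinAt_univ, ← Set.Iic_union_Ici (a := s)]
    refine HasDerivWithinAt.union ?_ ?_
    · exact (hf s le_rfl).hasDerivWithinAt.congr (fun t ht => if_pos ht) (if_pos le_rfl)
    · rw [h']
      refine (hg s le_rfl).hasDerivWithinAt.congr (fun t ht => ?_) (by rw [if_pos le_rfl, h])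
      rcases eq_or_lt_of_le (Set.mem_Ici.1 ht) with rfl | ht'
      · rw [if_pos le_rfl, h]
      · exact if_neg (not_le.2 ht')
  · rw [if_neg (not_le.2 hs)]
    refine (hg s hs.le).congr_of_eventuallyEq ?_
    filter_upwards [Ioi_mem_nhds hs] with t ht
    exact if_neg (not_le.2 ht)

/-- `1 / √s`, continued below `s = 4` by its second order Taylor polynomial. -/
noncomputable def newtonProfile (s : ℝ) : ℝ :=
  if s ≤ 4 then 1 / 2 - (s - 4) / 16 + 3 / 256 * (s - 4) ^ 2 else (√s)⁻¹

/-- Twice the derivative of `newtonProfile`. -/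
noncomputable def newtonSlope (s : ℝ) : ℝ :=
  if s ≤ 4 then 3 / 64 * s - 5 / 16 else -((√s)⁻¹ ^ 3)

theorem sqrt_four : √(4 : ℝ) = 2 := by
  rw [show (4 : ℝ) = 2 ^ 2 by norm_num, Real.sqrt_sq zero_le_two]

theorem hasDerivAt_inv_sqrt {s : ℝ} (hs : 0 < s) :
    HasDerivAt (fun s => (√s)⁻¹) (-((√s)⁻¹ ^ 3) / 2) s := by
  refine ((Real.hasDerivAt_sqrt hs.ne').inv (Real.sqrt_pos.2 hs).ne').congr_deriv ?_
  have := (Real.sqrt_pos.2 hs).ne'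
  field_simp

theorem hasDerivAt_newtonProfile (s : ℝ) : HasDerivAt newtonProfile (newtonSlope s / 2) s := by
  have := hasDerivAt_ite_le (f := fun s : ℝ => 1 / 2 - (s - 4) / 16 + 3 / 256 * (s - 4) ^ 2)
    (g := fun s => (√s)⁻¹) (f' := fun s => (3 / 64 * s - 5 / 16) / 2)
    (g' := fun s => -((√s)⁻¹ ^ 3) / 2) (c := 4) (fun s _ => ?_)
    (fun s hs => hasDerivAt_inv_sqrt (by linarith)) (by norm_num [sqrt_four])
    (by norm_num [sqrt_four]) s
  · unfold newtonProfile newtonSlope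
    refine this.congr_deriv ?_
    split_ifs <;> rfl
  · have h1 : HasDerivAt (fun s : ℝ => s - 4) 1 s := (hasDerivAt_id s).sub_const 4
    refine (((hasDerivAt_const s (1 / 2 : ℝ)).sub (h1.div_const 16)).add
      ((h1.pow 2).const_mul (3 / 256))).congr_deriv ?_
    simp
    ring

/-- The derivative of `newtonSlope`. -/
noncomputable def newtonSlopeDeriv (s : ℝ) : ℝ :=
  if s ≤ 4 then 3 / 64 else 3 / 2 * (√s)⁻¹ ^ 5

theorem hasDerivAt_newtonSlope (s : ℝ) : HasDerivAt newtonSlope (newtonSlopeDeriv s) s := by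
  refine hasDerivAt_ite_le (f := fun s : ℝ => 3 / 64 * s - 5 / 16)
    (g := fun s => -((√s)⁻¹ ^ 3)) (f' := fun _ => 3 / 64)
    (g' := fun s => 3 / 2 * (√s)⁻¹ ^ 5) (c := 4) (fun s _ => ?_) (fun s hs => ?_)
    (by norm_num [sqrt_four]) (by norm_num [sqrt_four]) s
  · simpa using ((hasDerivAt_id s).const_mul (3 / 64)).sub_const (5 / 16)
  · refine ((hasDerivAt_inv_sqrt (by linarith : 0 < s)).pow 3).neg.congr_deriv ?_
    simp
    ring

theorem continuous_newtonSlopeDeriv : Continuous newtonSlopeDeriv := by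
  unfold newtonSlopeDeriv
  refine continuous_if_le continuous_id continuous_const continuousOn_const ?_ ?_
  · refine continuousOn_const.mul (ContinuousOn.pow (ContinuousOn.inv₀
      Real.continuous_sqrt.continuousOn fun s hs => ?_) 5)
    exact (Real.sqrt_pos.2 (lt_of_lt_of_le four_pos hs)).ne'
  · rintro s rfl
    norm_num [sqrt_four]

theorem contDiff_newtonSlope : ContDiff ℝ 1 newtonSlope := by
  rw [contDiff_one_iff_deriv]
  refine ⟨fun s => (hasDerivAt_newtonSlope s).differentiableAt, ?_⟩
  rw [show deriv newtonSlope = newtonSlopeDeriv from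
    funext fun s => (hasDerivAt_newtonSlope s).deriv]
  exact continuous_newtonSlopeDeriv

/-- A superharmonic `C²` function on `ℝ³` that equals `1 / ‖y‖` for `‖y‖ ≥ 2`. -/
noncomputable def newtonKernel (y : E3) : ℝ := newtonProfile (‖y‖ ^ 2)

/-- The gradient of `newtonKernel`. -/
noncomputable def newtonField (j : Fin 3) (y : E3) : ℝ := newtonSlope (‖y‖ ^ 2) * y j

/-- The negative Laplacian of `newtonKernel`. -/
noncomputable def newtonDensity (y : E3) : ℝ := 15 / 64 * max (4 - ‖y‖ ^ 2) 0

theorem newtonKernel_of_two_le {y : E3} (hy : 2 ≤ ‖y‖) : newtonKernel y = ‖y‖⁻¹ := by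
  unfold newtonKernel newtonProfile
  split_ifs with h
  · have : ‖y‖ = 2 := by nlinarith
    rw [this]
    norm_num
  · rw [Real.sqrt_sq (norm_nonneg y)]

theorem newtonSlope_of_two_le {y : E3} (hy : 2 ≤ ‖y‖) : newtonSlope (‖y‖ ^ 2) = -(‖y‖⁻¹ ^ 3) := by
  unfold newtonSlope
  split_ifs with h
  · have : ‖y‖ = 2 := by nlinarith
    rw [this]
    norm_num
  · rw [Real.sqrt_sq (norm_nonneg y)]

theorem newtonKernel_nonneg (y : E3) : 0 ≤ newtonKernel y := by
  unfold newtonKernel newtonProfile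
  split_ifs with h
  · nlinarith [sq_nonneg (‖y‖ ^ 2 - 4)]
  · positivity

theorem inv_le_three_mul_nu {y : E3} (hy : 2 ≤ ‖y‖) : ‖y‖⁻¹ ≤ 3 * nu y := by
  have h0 : 0 < ‖y‖ := by linarith
  rw [nu, ← div_eq_mul_inv, inv_eq_one_div, div_le_div_iff₀ h0 (by positivity), one_mul]
  refine (Real.sqrt_le_sqrt (y := (3 * ‖y‖) ^ 2) (by nlinarith)).trans_eq ?_
  exact Real.sqrt_sq (by positivity)

theorem one_le_three_mul_nu {y : E3} (hy : ‖y‖ ≤ 2) : 1 ≤ 3 * nu y := by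
  rw [nu, ← div_eq_mul_inv, le_div_iff₀ (by positivity), one_mul]
  refine (Real.sqrt_le_sqrt (y := 3 ^ 2) (by nlinarith [norm_nonneg y])).trans_eq ?_
  exact Real.sqrt_sq (by norm_num)

theorem newtonKernel_le (y : E3) : newtonKernel y ≤ 3 * nu y := by
  rcases le_total 2 ‖y‖ with h | h
  · rw [newtonKernel_of_two_le h]
    exact inv_le_three_mul_nu h
  · refine le_trans ?_ (one_le_three_mul_nu h)
    have h4 : ‖y‖ ^ 2 ≤ 4 := by nlinarith [norm_nonneg y]
    rw [newtonKernel, newtonProfile, if_pos h4]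
    nlinarith [sq_nonneg ‖y‖]

theorem abs_newtonSlope_mul_norm_le (y : E3) :
    |newtonSlope (‖y‖ ^ 2)| * ‖y‖ ≤ 5 * nu y ^ 2 := by
  rw [nu_sq]
  rcases le_total 2 ‖y‖ with h | h
  · rw [newtonSlope_of_two_le h, abs_neg, abs_of_nonneg (by positivity)]
    have h0 : 0 < ‖y‖ := by linarith
    rw [show ‖y‖⁻¹ ^ 3 * ‖y‖ = 1 / ‖y‖ ^ 2 by field_simp, ← div_eq_mul_inv,
      div_le_div_iff₀ (by positivity) (by positivity)]
    nlinarith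
  · have h4 : ‖y‖ ^ 2 ≤ 4 := by nlinarith [norm_nonneg y]
    have h1 : |newtonSlope (‖y‖ ^ 2)| ≤ 5 / 16 := by
      rw [newtonSlope, if_pos h4, abs_le]
      constructor <;> nlinarith [sq_nonneg ‖y‖]
    have h2 : 1 ≤ 5 * (1 + ‖y‖ ^ 2)⁻¹ := by
      rw [← div_eq_mul_inv, le_div_iff₀ (by positivity)]
      linarith
    refine le_trans ?_ h2
    calc |newtonSlope (‖y‖ ^ 2)| * ‖y‖ ≤ 5 / 16 * 2 := by gcongr
      _ ≤ 1 := by norm_num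

theorem hasFDerivAt_newtonKernel (y : E3) :
    HasFDerivAt newtonKernel (newtonSlope (‖y‖ ^ 2) • innerSL ℝ y) y := by
  refine ((hasDerivAt_newtonProfile (‖y‖ ^ 2)).comp_hasFDerivAt y
    (hasStrictFDerivAt_norm_sq y).hasFDerivAt).congr_fderiv ?_
  rw [two_smul, ← two_smul ℝ, smul_smul]
  congr 1
  ring

theorem pderiv_newtonKernel (j : Fin 3) (y : E3) : pderiv j newtonKernel y = newtonField j y := by
  rw [pderiv_of_hasFDerivAt (hasFDerivAt_newtonKernel y)]
  simp [newtonField, EuclideanSpace.inner_single_right]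

theorem contDiff_newtonField (j : Fin 3) : ContDiff ℝ 1 (newtonField j) :=
  (contDiff_newtonSlope.comp (contDiff_norm_sq ℝ)).mul (contDiff_piLp_apply 2)

theorem contDiff_newtonKernel : ContDiff ℝ 1 newtonKernel := by
  have : ContDiff ℝ 1 newtonProfile := by
    rw [contDiff_one_iff_deriv]
    refine ⟨fun s => (hasDerivAt_newtonProfile s).differentiableAt, ?_⟩
    rw [show deriv newtonProfile = fun s => newtonSlope s / 2 from
      funext fun s => (hasDerivAt_newtonProfile s).deriv]
    exact contDiff_newtonSlope.continuous.div_const 2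
  exact this.comp (contDiff_norm_sq ℝ)

/-- With s = |y|² and σ the slope, the divergence of σ(s) y is 3σ + 2sσ'. For s ≤ 4 this is
-(15/64)(4 - s); beyond, the kernel is harmonic. The sign makes the kernel superharmonic. -/
theorem sum_pderiv_newtonField (y : E3) :
    ∑ j, pderiv j (newtonField j) y = -newtonDensity y := by
  have h1 : ∀ j, pderiv j (newtonField j) y =
      newtonSlope (‖y‖ ^ 2) + 2 * newtonSlopeDeriv (‖y‖ ^ 2) * (y j * y j) := by
    intro j
    have e1 := (hasDerivAt_newtonSlope (‖y‖ ^ 2)).comp_hasFDerivAt y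
      (hasStrictFDerivAt_norm_sq y).hasFDerivAt
    have e2 : HasFDerivAt (fun y : E3 => y j) (EuclideanSpace.proj j : E3 →L[ℝ] ℝ) y :=
      (EuclideanSpace.proj j : E3 →L[ℝ] ℝ).hasFDerivAt
    rw [pderiv_of_hasFDerivAt (f := newtonField j) (e1.mul e2)]
    simp [EuclideanSpace.inner_single_right]
    ring
  simp only [h1, Finset.sum_add_distrib, ← Finset.mul_sum]
  rw [sum_mul_self_eq_norm_sq]
  simp only [Finset.sum_const, Finset.card_univ, Fintype.card_fin, nsmul_eq_mul]
  unfold newtonDensity newtonSlope newtonSlopeDeriv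
  split_ifs with h
  · rw [max_eq_left (by linarith)]
    push_cast
    ring
  · have h0 : 0 < ‖y‖ := by
      by_contra hc
      have : ‖y‖ = 0 := le_antisymm (not_lt.1 hc) (norm_nonneg y)
      rw [this] at h
      norm_num at h
    rw [max_eq_right (by linarith), Real.sqrt_sq h0.le]
    field_simp
    norm_num

theorem newtonDensity_nonneg (y : E3) : 0 ≤ newtonDensity y :=
  mul_nonneg (by norm_num) (le_max_right _ _)

theorem newtonDensity_of_two_le {y : E3} (hy : 2 ≤ ‖y‖) : newtonDensity y = 0 := by
  rw [newtonDensity, max_eq_right (by nlinarith), mul_zero]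

theorem continuous_newtonDensity : Continuous newtonDensity := by
  unfold newtonDensity
  fun_prop

theorem integrable_newtonDensity : Integrable newtonDensity :=
  continuous_newtonDensity.integrable_of_hasCompactSupport <|
    HasCompactSupport.intro (isCompact_closedBall (0 : E3) 2) fun y hy =>
      newtonDensity_of_two_le (le_of_lt (by simpa using hy))

theorem setIntegral_ball_newtonDensity_sub_nonneg (c : E3) (r : ℝ) :
    0 ≤ ∫ x in Metric.ball (0 : E3) r, newtonDensity (x - c) :=
  integral_nonneg fun _ => newtonDensity_nonneg _

theorem setIntegral_ball_newtonDensity_sub {c : E3} {r : ℝ} (hr : ‖c‖ + 2 ≤ r) :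
    ∫ x in Metric.ball (0 : E3) r, newtonDensity (x - c) = ∫ y, newtonDensity y := by
  rw [setIntegral_eq_integral_of_forall_compl_eq_zero, integral_sub_right_eq_self]
  intro x hx
  refine newtonDensity_of_two_le ?_
  have h1 : r ≤ ‖x‖ := by simpa using hx
  have := norm_sub_norm_le x c
  linarith

theorem sphereFlux_newtonField {c : E3} {r : ℝ} (hr : 0 < r) :
    sphereFlux (fun j x => -newtonField j (x - c)) r =
      ∫ x in Metric.ball (0 : E3) r, newtonDensity (x - c) := by
  rw [sphereFlux_eq_integral_ball (X := fun j x => -newtonField j (x - c))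
    (fun j => ((contDiff_newtonField j).comp (contDiff_id.sub contDiff_const)).neg) hr]
  congr 1
  funext x
  have : ∀ j, pderiv j (fun x => -newtonField j (x - c)) x = -pderiv j (newtonField j) (x - c) := by
    intro j
    have h1 := (((contDiff_newtonField j).differentiable one_ne_zero) (x - c)).hasFDerivAt
    have h2 : HasFDerivAt (fun y : E3 => newtonField j (y - c)) _ x :=
      h1.comp x (f := fun y : E3 => y - c) ((hasFDerivAt_id x).sub_const c)
    rw [pderiv_of_hasFDerivAt (f := fun x => -newtonField j (x - c)) h2.neg]
    simp [pderiv]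
  simp only [this, Finset.sum_neg_distrib, sum_pderiv_newtonField, neg_neg]

/-- The sphere of radius 3 encloses the support of the density, and the outward field there has size
1/9 on an area of 36π. -/
theorem integral_newtonDensity : ∫ y, newtonDensity y = 4 * Real.pi := by
  have h := sphereFlux_newtonField (c := 0) (r := 3) (by norm_num)
  rw [setIntegral_ball_newtonDensity_sub (by simp; norm_num)] at h
  rw [← h, sphereFlux, sphereIntegral_congr (by norm_num) (G := fun _ => 1 / 9),
    sphereIntegral_const]
  · ring
  · intro x hx
    have e : ∑ j, -newtonField j (x - 0) * (x j / ‖x‖) =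
        -newtonSlope (‖x‖ ^ 2) / ‖x‖ * ∑ j, x j * x j := by
      rw [Finset.mul_sum]
      exact Finset.sum_congr rfl fun j _ => by rw [newtonField, sub_zero]; ring
    rw [e, sum_mul_self_eq_norm_sq, newtonSlope_of_two_le (by rw [hx]; norm_num), hx]
    norm_num

theorem sum_newtonField_mul (y v : E3) :
    ∑ j, newtonField j y * v j = newtonSlope (‖y‖ ^ 2) * ∑ j, y j * v j := by
  rw [Finset.mul_sum]
  exact Finset.sum_congr rfl fun j _ => by rw [newtonField]; ring

theorem abs_sum_newtonField_mul_le (y v : E3) :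
    |∑ j, newtonField j y * v j| ≤ 5 * nu y ^ 2 * ‖v‖ := by
  rw [sum_newtonField_mul, abs_mul]
  calc |newtonSlope (‖y‖ ^ 2)| * |∑ j, y j * v j|
      ≤ |newtonSlope (‖y‖ ^ 2)| * (‖y‖ * ‖v‖) := by gcongr; exact abs_sum_mul_le y v
    _ = |newtonSlope (‖y‖ ^ 2)| * ‖y‖ * ‖v‖ := by ring
    _ ≤ _ := mul_le_mul_of_nonneg_right (abs_newtonSlope_mul_norm_le y) (norm_nonneg v)

theorem abs_apply_le_norm (x : E3) (j : Fin 3) : |x j| ≤ ‖x‖ := by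
  simpa using PiLp.norm_apply_le x j

theorem abs_newtonField_le (j : Fin 3) (y : E3) : |newtonField j y| ≤ 5 * nu y ^ 2 := by
  rw [newtonField, abs_mul]
  refine le_trans ?_ (abs_newtonSlope_mul_norm_le y)
  gcongr
  exact abs_apply_le_norm y j

theorem nu_sq_le_nu (y : E3) : nu y ^ 2 ≤ nu y := by
  nlinarith [nu_pos y, nu_le_one y]

/-! ### The regularized potential of infinitely many masses -/

/-- The potential `1 + ∑ₗ (mₗ / 2) N(x - cₗ)` with the regularized kernel. -/
noncomputable def regFactor (m : ℕ → ℝ) (c : ℕ → E3) (x : E3) : ℝ :=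
  1 + ∑' l, m l / 2 * newtonKernel (x - c l)

/-- The gradient of `regFactor`. -/
noncomputable def regGrad (m : ℕ → ℝ) (c : ℕ → E3) (j : Fin 3) (x : E3) : ℝ :=
  ∑' l, m l / 2 * newtonField j (x - c l)

/-- Peetre's inequality compares ν(y - c) with ν(x - c) uniformly in c, so summability at one point
spreads to all. -/
theorem summable_mul_nu_of_summable {m : ℕ → ℝ} {c : ℕ → E3} (hm : ∀ l, 0 ≤ m l) {x : E3}
    (h : Summable fun l => m l * nu (x - c l)) (y : E3) :
    Summable fun l => m l * nu (y - c l) := by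
  refine (h.mul_left (√(2 * (1 + ‖y - x‖ ^ 2)))).of_nonneg_of_le
    (fun l => mul_nonneg (hm l) (nu_pos _).le) fun l => ?_
  have := nu_le_mul_nu (y - c l) (x - c l)
  rw [sub_sub_sub_cancel_right] at this
  calc m l * nu (y - c l) ≤ m l * (√(2 * (1 + ‖y - x‖ ^ 2)) * nu (x - c l)) :=
        mul_le_mul_of_nonneg_left this (hm l)
    _ = _ := by ring

theorem summable_mul_newtonKernel {m : ℕ → ℝ} {c : ℕ → E3} (hm : ∀ l, 0 ≤ m l) {x : E3}
    (hS : Summable fun l => m l * nu (x - c l)) :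
    Summable fun l => m l / 2 * newtonKernel (x - c l) := by
  refine (hS.mul_left (3 / 2)).of_nonneg_of_le
    (fun l => mul_nonneg (by linarith [hm l]) (newtonKernel_nonneg _)) fun l => ?_
  have := mul_le_mul_of_nonneg_left (newtonKernel_le (x - c l)) (hm l)
  linarith

theorem one_le_regFactor {m : ℕ → ℝ} {c : ℕ → E3} (hm : ∀ l, 0 ≤ m l) (x : E3) :
    1 ≤ regFactor m c x :=
  le_add_of_nonneg_right <| tsum_nonneg fun l =>
    mul_nonneg (by linarith [hm l]) (newtonKernel_nonneg _)

theorem regFactor_sub_one_le {m : ℕ → ℝ} {c : ℕ → E3} (hm : ∀ l, 0 ≤ m l) {x : E3}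
    (hS : Summable fun l => m l * nu (x - c l)) :
    regFactor m c x - 1 ≤ 3 / 2 * ∑' l, m l * nu (x - c l) := by
  rw [regFactor, add_sub_cancel_left, ← tsum_mul_left]
  refine (summable_mul_newtonKernel hm hS).tsum_le_tsum (fun l => ?_) (hS.mul_left _)
  have := mul_le_mul_of_nonneg_left (newtonKernel_le (x - c l)) (hm l)
  linarith

theorem summable_mul_nu_sq {m : ℕ → ℝ} {c : ℕ → E3} (hm : ∀ l, 0 ≤ m l) {x : E3}
    (hS : Summable fun l => m l * nu (x - c l)) : Summable fun l => m l * nu (x - c l) ^ 2 :=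
  hS.of_nonneg_of_le (fun l => mul_nonneg (hm l) (sq_nonneg _)) fun l =>
    mul_le_mul_of_nonneg_left (nu_sq_le_nu _) (hm l)

theorem abs_mul_newtonField_le {m : ℕ → ℝ} {c : ℕ → E3} (hm : ∀ l, 0 ≤ m l) (j : Fin 3) (x : E3)
    (l : ℕ) : |m l / 2 * newtonField j (x - c l)| ≤ 5 / 2 * (m l * nu (x - c l) ^ 2) := by
  rw [abs_mul, abs_of_nonneg (by linarith [hm l])]
  have := mul_le_mul_of_nonneg_left (abs_newtonField_le j (x - c l)) (hm l)
  linarith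

theorem summable_mul_newtonField {m : ℕ → ℝ} {c : ℕ → E3} (hm : ∀ l, 0 ≤ m l) {x : E3}
    (hS : Summable fun l => m l * nu (x - c l)) (j : Fin 3) :
    Summable fun l => m l / 2 * newtonField j (x - c l) :=
  ((summable_mul_nu_sq hm hS).mul_left (5 / 2)).of_norm_bounded fun l =>
    abs_mul_newtonField_le hm j x l

theorem sum_regGrad_mul {m : ℕ → ℝ} {c : ℕ → E3} (hm : ∀ l, 0 ≤ m l) {x : E3}
    (hS : Summable fun l => m l * nu (x - c l)) (v : E3) :
    ∑ j, regGrad m c j x * v j = ∑' l, m l / 2 * ∑ j, newtonField j (x - c l) * v j := by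
  simp only [regGrad, ← tsum_mul_right]
  rw [← Summable.tsum_finsetSum fun j _ => (summable_mul_newtonField hm hS j).mul_right _]
  refine tsum_congr fun l => ?_
  rw [Finset.mul_sum]
  exact Finset.sum_congr rfl fun j _ => mul_assoc _ _ _

theorem abs_sum_regGrad_mul_le {m : ℕ → ℝ} {c : ℕ → E3} (hm : ∀ l, 0 ≤ m l) {x : E3}
    (hS : Summable fun l => m l * nu (x - c l)) (v : E3) :
    |∑ j, regGrad m c j x * v j| ≤ 5 / 2 * (∑' l, m l * nu (x - c l) ^ 2) * ‖v‖ := by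
  rw [sum_regGrad_mul hm hS, ← tsum_mul_left, ← tsum_mul_right, ← Real.norm_eq_abs]
  refine tsum_of_norm_bounded (((summable_mul_nu_sq hm hS).mul_left _).mul_right _).hasSum
    fun l => ?_
  rw [Real.norm_eq_abs, abs_mul, abs_of_nonneg (by linarith [hm l])]
  have := mul_le_mul_of_nonneg_left (abs_sum_newtonField_mul_le (x - c l) v) (hm l)
  linarith

theorem norm_fderiv_newtonKernel_le (y : E3) :
    ‖newtonSlope (‖y‖ ^ 2) • (innerSL ℝ y : E3 →L[ℝ] ℝ)‖ ≤ 5 * nu y := by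
  rw [norm_smul, innerSL_apply_norm, Real.norm_eq_abs]
  linarith [abs_newtonSlope_mul_norm_le y, nu_sq_le_nu y]

/-- Termwise differentiation on the unit ball about x: there the Peetre factor is at most 2, so the
derivatives have the summable majorant 5 m_l ν(x - c_l). -/
theorem hasFDerivAt_regFactor {m : ℕ → ℝ} {c : ℕ → E3} (hm : ∀ l, 0 ≤ m l) {x : E3}
    (hS : Summable fun l => m l * nu (x - c l)) :
    HasFDerivAt (regFactor m c)
      (∑' l, (m l / 2) • (newtonSlope (‖x - c l‖ ^ 2) • innerSL ℝ (x - c l))) x := by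
  refine HasFDerivAt.const_add 1 (hasFDerivAt_tsum_of_isPreconnected
    (f := fun l x => m l / 2 * newtonKernel (x - c l))
    (f' := fun l x => (m l / 2) • (newtonSlope (‖x - c l‖ ^ 2) • innerSL ℝ (x - c l)))
    (u := fun l => 5 * (m l * nu (x - c l)))
    (hS.mul_left 5) Metric.isOpen_ball (convex_ball x 1).isPreconnected ?_ ?_
    (Metric.mem_ball_self one_pos) (summable_mul_newtonKernel hm hS)
    (Metric.mem_ball_self one_pos))
  · intro l y _
    exact ((hasFDerivAt_newtonKernel (y - c l)).comp y (f := fun y : E3 => y - c l)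
      ((hasFDerivAt_id y).sub_const (c l))).const_mul (m l / 2)
  · intro l y hy
    rw [norm_smul, Real.norm_of_nonneg (by linarith [hm l])]
    have h1 := norm_fderiv_newtonKernel_le (y - c l)
    have h2 := nu_le_mul_nu (y - c l) (x - c l)
    rw [sub_sub_sub_cancel_right] at h2
    have h3 : √(2 * (1 + ‖y - x‖ ^ 2)) ≤ 2 := by
      rw [Real.sqrt_le_left (by norm_num)]
      have : ‖y - x‖ < 1 := by simpa [dist_eq_norm] using hy
      nlinarith [norm_nonneg (y - x)]
    have h4 : nu (y - c l) ≤ 2 * nu (x - c l) :=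
      h2.trans (mul_le_mul_of_nonneg_right h3 (nu_pos _).le)
    calc m l / 2 * ‖newtonSlope (‖y - c l‖ ^ 2) • innerSL ℝ (y - c l)‖
        ≤ m l / 2 * (5 * (2 * nu (x - c l))) := by
          refine mul_le_mul_of_nonneg_left ?_ (by linarith [hm l])
          linarith
      _ = _ := by ring

theorem pderiv_regFactor {m : ℕ → ℝ} {c : ℕ → E3} (hm : ∀ l, 0 ≤ m l) {x : E3}
    (hS : Summable fun l => m l * nu (x - c l)) (j : Fin 3) :
    pderiv j (regFactor m c) x = regGrad m c j x := by
  rw [pderiv_of_hasFDerivAt (hasFDerivAt_regFactor hm hS), regGrad]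
  have hsum : Summable fun l => (m l / 2) • (newtonSlope (‖x - c l‖ ^ 2) • innerSL ℝ (x - c l)) := by
    refine (hS.mul_left (5 / 2)).of_norm_bounded fun l => ?_
    rw [norm_smul, Real.norm_of_nonneg (by linarith [hm l])]
    have := mul_le_mul_of_nonneg_left (norm_fderiv_newtonKernel_le (x - c l)) (hm l)
    linarith
  have h := (ContinuousLinearMap.apply ℝ ℝ (EuclideanSpace.single j (1 : ℝ) : E3)).map_tsum hsum
  simp only [ContinuousLinearMap.apply_apply] at h
  rw [h]
  refine tsum_congr fun l => ?_
  simp [newtonField, EuclideanSpace.inner_single_right]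

/-- Away from the balls of radius two, the regularized potential is the Brill--Lindquist one. -/
theorem blFactor_eq_regFactor {m : ℕ → ℝ} {c : ℕ → E3} {x : E3} (h : ∀ l, 2 ≤ ‖x - c l‖) :
    blFactor m c x = regFactor m c x := by
  rw [blFactor, regFactor]
  congr 1
  refine tsum_congr fun l => ?_
  rw [newtonKernel_of_two_le (h l), div_mul_eq_div_div, div_eq_mul_inv]

theorem tsum_eq_add_tsum_ne {f : ℕ → ℝ} (hf : Summable f) (k : ℕ) :
    ∑' l, f l = f k + ∑' l : {l // l ≠ k}, f l := by
  have := hf.tsum_subtype_add_tsum_subtype_compl {k}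
  rw [← this, tsum_singleton]
  rfl

/-! ### Interaction sums and the geometry of the centers -/

namespace IsLocalizedBL

variable {m : ℕ → ℝ} {p : ℕ → E3} {lam : ℝ} {δ : ℕ → ℝ} {ε₀ C : ℝ} {g : TensorField}

theorem norm_sub_center_ge (h : IsLocalizedBL m p lam δ ε₀ C g) (k l : ℕ) :
    ‖p k - p l‖ ≤ ‖lam • p k - lam • p l‖ := by
  rw [← smul_sub, norm_smul, Real.norm_of_nonneg (by linarith [h.one_le_lam])]
  exact le_mul_of_one_le_left (norm_nonneg _) h.one_le_lam

theorem five_le_norm_sub (h : IsLocalizedBL m p lam δ ε₀ C g) {k l : ℕ} (hkl : k ≠ l) :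
    5 ≤ ‖lam • p k - lam • p l‖ :=
  (h.separated k l hkl).trans (h.norm_sub_center_ge k l)

/-- ν(x - c_l) ≤ 1/|x - c_l| ≤ 3/|c_k - c_l| ≤ 3/|p_k - p_l|, the last because scaling by λ ≥ 1
increases distances. This converts bounds on interactions at p_k into bounds at every x for which
c_k is an almost nearest center. -/
theorem mul_nu_le (h : IsLocalizedBL m p lam δ ε₀ C g) {k : ℕ} {x : E3}
    (hx : ∀ l, l ≠ k → ‖lam • p k - lam • p l‖ ≤ 3 * ‖x - lam • p l‖) {l : ℕ} (hl : l ≠ k) :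
    m l * nu (x - lam • p l) ≤ 3 * (m l / ‖p k - p l‖) := by
  have h1 := h.separated k l hl.symm
  have h2 := h.norm_sub_center_ge k l
  have h3 := hx l hl
  have h4 : 0 < ‖x - lam • p l‖ := by linarith
  have h5 : nu (x - lam • p l) ≤ 3 / ‖p k - p l‖ := by
    refine (nu_le_inv_norm (norm_pos_iff.1 h4)).trans ?_
    rw [inv_eq_one_div, div_le_div_iff₀ h4 (by linarith)]
    linarith
  calc m l * nu (x - lam • p l) ≤ m l * (3 / ‖p k - p l‖) :=
        mul_le_mul_of_nonneg_left h5 (h.mass_pos l).le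
    _ = _ := by ring

theorem summable_mul_nu (h : IsLocalizedBL m p lam δ ε₀ C g) (x : E3) :
    Summable fun l => m l * nu (x - lam • p l) := by
  -- It suffices to sum at the center c_0, where the terms with l ≠ 0 are dominated by the
  -- interaction sum of p_0.
  refine summable_mul_nu_of_summable (x := lam • p 0) (fun l => (h.mass_pos l).le) ?_ x
  rw [← Finset.summable_compl_iff {0}]
  have h1 : Summable fun l : {l // l ∉ ({0} : Finset ℕ)} => 3 * (m l / ‖p 0 - p l‖) := by
    have := (h.interaction_summable 0).mul_left 3
    rw [← (Equiv.subtypeEquivRight (p := fun l : ℕ => l ∉ ({0} : Finset ℕ))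
      (q := fun l => l ≠ 0) (by simp)).summable_iff] at this
    exact this
  refine h1.of_nonneg_of_le (fun l => mul_nonneg (h.mass_pos l).le (nu_pos _).le) fun l => ?_
  refine h.mul_nu_le (fun l _ => ?_) (by simpa using l.2)
  linarith [norm_nonneg (lam • p 0 - lam • p l)]

theorem tsum_ne_mul_nu_le (h : IsLocalizedBL m p lam δ ε₀ C g) {k : ℕ} {x : E3}
    (hx : ∀ l, l ≠ k → ‖lam • p k - lam • p l‖ ≤ 3 * ‖x - lam • p l‖) :
    ∑' l : {l // l ≠ k}, m l * nu (x - lam • p l) ≤ 3 * δ k := by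
  have h1 := (h.interaction_summable k).mul_left 3
  have h2 : Summable fun l : {l // l ≠ k} => m l * nu (x - lam • p l) :=
    (h.summable_mul_nu x).subtype _
  refine (h2.tsum_le_tsum (fun l => h.mul_nu_le hx l.2) h1).trans ?_
  rw [tsum_mul_left]
  exact mul_le_mul_of_nonneg_left (h.interaction_le k) (by norm_num)

theorem tsum_mul_nu_le (h : IsLocalizedBL m p lam δ ε₀ C g) {k : ℕ} {x : E3}
    (hx : ∀ l, l ≠ k → ‖lam • p k - lam • p l‖ ≤ 3 * ‖x - lam • p l‖) :
    ∑' l, m l * nu (x - lam • p l) ≤ m k + 3 * δ k := by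
  rw [tsum_eq_add_tsum_ne (h.summable_mul_nu x) k]
  have := mul_le_of_le_one_right (h.mass_pos k).le (nu_le_one (x - lam • p k))
  linarith [h.tsum_ne_mul_nu_le hx]

/-- Every point has an almost nearest center. -/
theorem exists_almost_nearest (h : IsLocalizedBL m p lam δ ε₀ C g) (x : E3) :
    ∃ k, ∀ l, l ≠ k → ‖lam • p k - lam • p l‖ ≤ 3 * ‖x - lam • p l‖ := by
  have hb : BddBelow (Set.range fun l => ‖x - lam • p l‖) :=
    ⟨0, by rintro _ ⟨l, rfl⟩; exact norm_nonneg _⟩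
  -- The slack 1 avoids showing that the infimum is attained. With d = |x - c_l| it gives |c_k -
  -- c_l| ≤ 2d + 1; separation by 5 forces d ≥ 2, whence 2d + 1 ≤ 3d.
  obtain ⟨k, hk⟩ := exists_lt_of_ciInf_lt (lt_add_one (⨅ l, ‖x - lam • p l‖))
  refine ⟨k, fun l hl => ?_⟩
  have h1 : ‖x - lam • p k‖ < ‖x - lam • p l‖ + 1 :=
    hk.trans_le (add_le_add_left (ciInf_le hb l) 1)
  have h2 := h.five_le_norm_sub hl.symm
  have h3 := norm_sub_le (x - lam • p l) (x - lam • p k)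
  rw [sub_sub_sub_cancel_left] at h3
  linarith

/-- Here 5/2 is half the separation: within that distance of c_k, all other centers are at least as
far away. -/
theorem almost_nearest_of_norm_le (h : IsLocalizedBL m p lam δ ε₀ C g) {k : ℕ} {x : E3}
    (hx : ‖x - lam • p k‖ ≤ 5 / 2) {l : ℕ} (hl : l ≠ k) :
    ‖lam • p k - lam • p l‖ ≤ 3 * ‖x - lam • p l‖ ∧ 5 / 2 ≤ ‖x - lam • p l‖ := by
  have h2 := h.five_le_norm_sub hl.symm
  have h3 := norm_sub_le (x - lam • p l) (x - lam • p k)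
  rw [sub_sub_sub_cancel_left] at h3
  constructor <;> linarith

/-- The set of points off the closed balls of radius two about the centers is open. -/
theorem eventually_outside (h : IsLocalizedBL m p lam δ ε₀ C g) {x : E3}
    (hx : ∀ k, 2 < ‖x - lam • p k‖) : ∀ᶠ y in 𝓝 x, ∀ k, 2 < ‖y - lam • p k‖ := by
  -- Infinitely many strict inequalities must persist. Near a center only its own inequality can
  -- fail; if no center is within 5/2, all inequalities have a margin of 1/2.
  by_cases hk : ∃ k, ‖x - lam • p k‖ < 5 / 2
  · obtain ⟨k, hk⟩ := hk
    have h1 : ∀ᶠ y in 𝓝 x, 2 < ‖y - lam • p k‖ ∧ ‖y - lam • p k‖ < 5 / 2 := by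
      have hc : ContinuousAt (fun y => ‖y - lam • p k‖) x := by fun_prop
      exact (hc.eventually (lt_mem_nhds (hx k))).and (hc.eventually (gt_mem_nhds hk))
    filter_upwards [h1] with y hy l
    rcases eq_or_ne l k with rfl | hl
    · exact hy.1
    · linarith [(h.almost_nearest_of_norm_le hy.2.le hl).2]
  · push Not at hk
    filter_upwards [Metric.ball_mem_nhds x (show (0 : ℝ) < 1 / 2 by norm_num)] with y hy k
    have h1 := norm_sub_le_norm_sub_add_norm_sub x y (lam • p k)
    rw [mem_ball_iff_norm, norm_sub_rev] at hy
    linarith [hk k]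

end IsLocalizedBL

/-! ### The flux integrand: crude bounds and the conformally flat case -/

/-- The integrand of the ADM flux. -/
noncomputable def admIntegrand (g : TensorField) (x : E3) : ℝ :=
  ∑ a, ∑ b, ∑ j, (g x)⁻¹ a b *
    (pderiv b (fun y => g y a j) x - pderiv j (fun y => g y a b) x) * (x j / ‖x‖)

theorem IsSmoothMetric.continuous_inv {g : TensorField} (hg : IsSmoothMetric g) (a b : Fin 3) :
    Continuous fun x => (g x)⁻¹ a b := by
  have hc : Continuous fun x => g x := continuous_matrix fun i j => (hg.smooth i j).continuous
  have hinv : ∀ x, (g x)⁻¹ a b = (g x).det⁻¹ * (g x).adjugate a b := fun x => by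
    rw [Matrix.inv_def, Matrix.smul_apply, smul_eq_mul, Ring.inverse_eq_inv']
  simp only [hinv]
  refine (hc.matrix_det.inv₀ fun x => (hg.posDef x).det_pos.ne').mul ?_
  exact (continuous_apply_apply a b).comp hc.matrix_adjugate

theorem IsSmoothMetric.contDiff_one {g : TensorField} (hg : IsSmoothMetric g) (i j : Fin 3) :
    ContDiff ℝ 1 fun x => g x i j := (hg.smooth i j).of_le (by exact_mod_cast le_top)

theorem IsSmoothMetric.continuousOn_admIntegrand {g : TensorField} (hg : IsSmoothMetric g) :
    ContinuousOn (admIntegrand g) {0}ᶜ := by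
  refine continuousOn_finsetSum _ fun a _ => continuousOn_finsetSum _ fun b _ =>
    continuousOn_finsetSum _ fun j _ => ContinuousOn.mul (ContinuousOn.mul
      (hg.continuous_inv a b).continuousOn ?_) ?_
  · exact ((continuous_pderiv (hg.contDiff_one a j) b).sub
      (continuous_pderiv (hg.contDiff_one a b) j)).continuousOn
  · refine ContinuousOn.div (by fun_prop) continuous_norm.continuousOn fun x hx => ?_
    exact norm_ne_zero_iff.2 hx

/-- Entries of the inverse of a matrix bounded below. -/
theorem abs_inv_apply_le {A : Matrix (Fin 3) (Fin 3) ℝ} (hA : IsUnit A.det) {κ : ℝ} (hκ : 0 < κ)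
    (h : ∀ v : E3, κ * ‖v‖ ^ 2 ≤ ∑ i, ∑ j, A i j * v i * v j) (a b : Fin 3) :
    |A⁻¹ a b| ≤ 1 / κ := by
  -- For w the b-th column of the inverse, wᵀAw = w_b, so κ|w|² ≤ |w| and |w| ≤ 1/κ.
  set w : E3 := WithLp.toLp 2 fun i => A⁻¹ i b with hw
  have h1 : ∀ i, ∑ j, A i j * w j = (1 : Matrix (Fin 3) (Fin 3) ℝ) i b := fun i => by
    rw [← Matrix.mul_nonsing_inv A hA, Matrix.mul_apply]
  have h2 : ∑ i, ∑ j, A i j * w i * w j = w b := by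
    have : ∀ i, ∑ j, A i j * w i * w j = w i * (1 : Matrix (Fin 3) (Fin 3) ℝ) i b := fun i => by
      rw [← h1, Finset.mul_sum]
      exact Finset.sum_congr rfl fun j _ => by ring
    simp [this, Matrix.one_apply]
  have h3 := h w
  rw [h2] at h3
  have h4 := abs_apply_le_norm w b
  have h5 := abs_apply_le_norm w a
  have h6 : κ * ‖w‖ ≤ 1 := by
    by_contra hc
    push Not at hc
    have h7 : 0 < ‖w‖ := by
      rcases (norm_nonneg w).lt_or_eq with h | h
      · exact h
      · rw [← h] at hc; linarith
    nlinarith [le_abs_self (w b)]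
  refine h5.trans ?_
  rw [le_div_iff₀ hκ]
  linarith

/-- Matrices close to the identity are bounded below. -/
theorem half_norm_sq_le {A : Matrix (Fin 3) (Fin 3) ℝ}
    (h : ∀ i j, |A i j - (1 : Matrix (Fin 3) (Fin 3) ℝ) i j| ≤ 1 / 6) (v : E3) :
    1 / 2 * ‖v‖ ^ 2 ≤ ∑ i, ∑ j, A i j * v i * v j := by
  -- Summed over the nine pairs, the errors (v_i² + v_j²)/12 total |v|²/2.
  have h1 : ∀ i j, (1 : Matrix (Fin 3) (Fin 3) ℝ) i j * v i * v j - 1 / 12 * (v i ^ 2 + v j ^ 2)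
      ≤ A i j * v i * v j := by
    intro i j
    have h2 : -(1 / 12 * (v i ^ 2 + v j ^ 2)) ≤
        (A i j - (1 : Matrix (Fin 3) (Fin 3) ℝ) i j) * (v i * v j) := by
      refine neg_le_of_abs_le ?_
      rw [abs_mul, abs_mul]
      calc |A i j - (1 : Matrix (Fin 3) (Fin 3) ℝ) i j| * (|v i| * |v j|)
          ≤ 1 / 6 * (|v i| * |v j|) := by gcongr; exact h i j
        _ ≤ _ := by
          rw [← sq_abs (v i), ← sq_abs (v j)]
          nlinarith [sq_nonneg (|v i| - |v j|)]
    linarith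
  refine le_trans (le_of_eq ?_) (Finset.sum_le_sum fun i _ => Finset.sum_le_sum fun j _ => h1 i j)
  rw [EuclideanSpace.real_norm_sq_eq]
  simp [Fin.sum_univ_three, Matrix.one_apply]
  ring

theorem abs_admIntegrand_le {g : TensorField} {x : E3} {K B : ℝ}
    (hK : ∀ a b, |(g x)⁻¹ a b| ≤ K)
    (hB : ∀ l i j, |pderiv l (fun y => g y i j) x| ≤ B) :
    |admIntegrand g x| ≤ 54 * (K * B) := by
  have hK0 : 0 ≤ K := (abs_nonneg _).trans (hK 0 0)
  have hB0 : 0 ≤ B := (abs_nonneg _).trans (hB 0 0 0)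
  have hterm : ∀ a b j, |(g x)⁻¹ a b *
      (pderiv b (fun y => g y a j) x - pderiv j (fun y => g y a b) x) * (x j / ‖x‖)| ≤
      K * (2 * B) := by
    intro a b j
    rw [abs_mul, abs_mul]
    have h1 : |pderiv b (fun y => g y a j) x - pderiv j (fun y => g y a b) x| ≤ 2 * B :=
      (abs_sub _ _).trans (by linarith [hB b a j, hB j a b])
    have h2 : |x j / ‖x‖| ≤ 1 := by
      rw [abs_div, abs_norm]
      exact div_le_one_of_le₀ (abs_apply_le_norm x j) (norm_nonneg x)
    calc _ ≤ K * (2 * B) * 1 := by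
          gcongr
          exact hK a b
      _ = _ := mul_one _
  refine (Finset.abs_sum_le_sum_abs _ _).trans ?_
  refine (Finset.sum_le_sum fun a _ => (Finset.abs_sum_le_sum_abs _ _).trans
    (Finset.sum_le_sum fun b _ => (Finset.abs_sum_le_sum_abs _ _).trans
      (Finset.sum_le_sum fun j _ => hterm a b j))).trans (le_of_eq ?_)
  simp
  ring

theorem pderiv_congr {f f' : E3 → ℝ} {x : E3} (h : f =ᶠ[𝓝 x] f') (i : Fin 3) :
    pderiv i f x = pderiv i f' x := by
  rw [pderiv, pderiv, h.fderiv_eq]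

theorem pderiv_conformal {g : TensorField} {x : E3} {u : E3 → ℝ} {u' : E3 →L[ℝ] ℝ}
    (hu : HasFDerivAt u u' x)
    (hg : ∀ᶠ y in 𝓝 x, g y = u y ^ 4 • (1 : Matrix (Fin 3) (Fin 3) ℝ)) (l i j : Fin 3) :
    pderiv l (fun y => g y i j) x =
      (1 : Matrix (Fin 3) (Fin 3) ℝ) i j * (4 * u x ^ 3 * pderiv l u x) := by
  have h1 : (fun y => g y i j) =ᶠ[𝓝 x] fun y => u y ^ 4 * (1 : Matrix (Fin 3) (Fin 3) ℝ) i j := by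
    filter_upwards [hg] with y hy
    rw [hy, Matrix.smul_apply, smul_eq_mul]
  rw [pderiv_congr h1, pderiv_of_hasFDerivAt hu, pderiv_of_hasFDerivAt
    ((hu.pow 4).mul_const ((1 : Matrix (Fin 3) (Fin 3) ℝ) i j))]
  simp

/-- The ADM integrand of a conformally flat metric. -/
theorem admIntegrand_conformal {g : TensorField} {x : E3} {u : E3 → ℝ} {u' : E3 →L[ℝ] ℝ}
    (hu : HasFDerivAt u u' x) (hu0 : u x ≠ 0)
    (hg : ∀ᶠ y in 𝓝 x, g y = u y ^ 4 • (1 : Matrix (Fin 3) (Fin 3) ℝ)) :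
    admIntegrand g x = -8 * (∑ j, pderiv j u x * (x j / ‖x‖)) / u x := by
  have hd := pderiv_conformal hu hg
  have hi : (g x)⁻¹ = (u x ^ 4)⁻¹ • (1 : Matrix (Fin 3) (Fin 3) ℝ) := by
    rw [hg.self_of_nhds]
    refine Matrix.inv_eq_right_inv ?_
    rw [Matrix.smul_mul, Matrix.one_mul, smul_smul, mul_inv_cancel₀ (pow_ne_zero 4 hu0), one_smul]
  unfold admIntegrand
  -- Contraction with u⁻⁴δ leaves (4/u)(∂_r u - 3 ∂_r u), which is where -8 comes from.
  simp only [hd, hi, Matrix.smul_apply, smul_eq_mul]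
  simp [Fin.sum_univ_three, Matrix.one_apply]
  field_simp
  ring

/-! ### The flux integrand off and on the balls -/

namespace IsLocalizedBL

variable {m : ℕ → ℝ} {p : ℕ → E3} {lam : ℝ} {δ : ℕ → ℝ} {ε₀ C : ℝ} {g : TensorField}

theorem eventually_eq_regFactor (h : IsLocalizedBL m p lam δ ε₀ C g) {x : E3}
    (hx : ∀ k, 2 < ‖x - lam • p k‖) : ∀ᶠ y in 𝓝 x, g y =
      regFactor m (fun k => lam • p k) y ^ 4 • (1 : Matrix (Fin 3) (Fin 3) ℝ) := by
  filter_upwards [h.eventually_outside hx] with y hy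
  rw [h.outside y hy, blFactor_eq_regFactor fun l => (hy l).le]

theorem hasFDerivAt_regFactor (h : IsLocalizedBL m p lam δ ε₀ C g) (x : E3) :
    HasFDerivAt (regFactor m fun k => lam • p k) (∑' l, (m l / 2) •
      (newtonSlope (‖x - lam • p l‖ ^ 2) • innerSL ℝ (x - lam • p l))) x :=
  _root_.hasFDerivAt_regFactor (fun l => (h.mass_pos l).le) (h.summable_mul_nu x)

theorem pderiv_regFactor (h : IsLocalizedBL m p lam δ ε₀ C g) (x : E3) (j : Fin 3) :
    pderiv j (regFactor m fun k => lam • p k) x = regGrad m (fun k => lam • p k) j x :=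
  _root_.pderiv_regFactor (fun l => (h.mass_pos l).le) (h.summable_mul_nu x) j

theorem one_le_regFactor (h : IsLocalizedBL m p lam δ ε₀ C g) (x : E3) :
    1 ≤ regFactor m (fun k => lam • p k) x :=
  _root_.one_le_regFactor (fun l => (h.mass_pos l).le) x

theorem admIntegrand_outside (h : IsLocalizedBL m p lam δ ε₀ C g) {x : E3}
    (hx : ∀ k, 2 < ‖x - lam • p k‖) :
    admIntegrand g x = -8 * (∑ j, regGrad m (fun k => lam • p k) j x * (x j / ‖x‖)) /
      regFactor m (fun k => lam • p k) x := by
  rw [admIntegrand_conformal (h.hasFDerivAt_regFactor x)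
    (zero_lt_one.trans_le (h.one_le_regFactor x)).ne' (h.eventually_eq_regFactor hx)]
  simp only [h.pderiv_regFactor]

/-- By continuity the bounds extend from the open to the closed ball, as needed because the
conformally flat form is given only strictly outside the closed balls. -/
theorem abs_sub_one_le (h : IsLocalizedBL m p lam δ ε₀ C g) {k : ℕ} {x : E3}
    (hx : ‖x - lam • p k‖ ≤ 2) (i j : Fin 3) :
    |g x i j - (1 : Matrix (Fin 3) (Fin 3) ℝ) i j| ≤ C * m k := by
  have hx' : x ∈ closure (Metric.ball (lam • p k) 2) := by
    rw [closure_ball _ two_ne_zero]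
    simpa [dist_eq_norm] using hx
  refine closure_minimal (s := Metric.ball (lam • p k) 2)
    (t := {y | |g y i j - (1 : Matrix (Fin 3) (Fin 3) ℝ) i j| ≤ C * m k}) (fun y hy => ?_)
    (isClosed_le (((h.metric.smooth i j).continuous.sub continuous_const).abs) continuous_const) hx'
  exact h.inside k y hy [] (by simp) i j

theorem abs_pderiv_le (h : IsLocalizedBL m p lam δ ε₀ C g) {k : ℕ} {x : E3}
    (hx : ‖x - lam • p k‖ ≤ 2) (l i j : Fin 3) :
    |pderiv l (fun y => g y i j) x| ≤ C * m k := by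
  have hx' : x ∈ closure (Metric.ball (lam • p k) 2) := by
    rw [closure_ball _ two_ne_zero]
    simpa [dist_eq_norm] using hx
  refine closure_minimal (s := Metric.ball (lam • p k) 2)
    (t := {y | |pderiv l (fun y => g y i j) y| ≤ C * m k}) (fun y hy => ?_)
    (isClosed_le (continuous_pderiv (h.metric.contDiff_one i j) l).abs continuous_const) hx'
  have := h.inside k y hy [l] (by simp) i j
  have e : iterPderiv [l] (fun y => g y i j - (1 : Matrix (Fin 3) (Fin 3) ℝ) i j) y =
      pderiv l (fun y => g y i j) y := by
    simp only [iterPderiv, List.foldr, pderiv, fderiv_sub_const]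
  rwa [e] at this

theorem abs_admIntegrand_inside_le (h : IsLocalizedBL m p lam δ ε₀ C g) {k : ℕ} {x : E3}
    (hx : ‖x - lam • p k‖ ≤ 2) {κ : ℝ} (hκ : 0 < κ)
    (hpos : ∀ v : E3, κ * ‖v‖ ^ 2 ≤ ∑ i, ∑ j, g x i j * v i * v j) :
    |admIntegrand g x| ≤ 54 * C / κ * m k := by
  refine (abs_admIntegrand_le (fun a b => abs_inv_apply_le
    (isUnit_iff_ne_zero.2 (h.metric.posDef x).det_pos.ne') hκ hpos a b)
    (h.abs_pderiv_le hx)).trans (le_of_eq ?_)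
  ring

theorem abs_regGrad_radial_le (h : IsLocalizedBL m p lam δ ε₀ C g) (x : E3) :
    |∑ j, regGrad m (fun k => lam • p k) j x * (x j / ‖x‖)| ≤
      5 / 2 * ∑' l, m l * nu (x - lam • p l) ^ 2 := by
  have h1 := abs_sum_regGrad_mul_le (fun l => (h.mass_pos l).le) (h.summable_mul_nu x)
    (‖x‖⁻¹ • x)
  have h2 : ‖‖x‖⁻¹ • x‖ ≤ 1 := by
    rw [norm_smul, norm_inv, norm_norm]
    exact inv_mul_le_one
  have h0 : 0 ≤ 5 / 2 * ∑' l, m l * nu (x - lam • p l) ^ 2 :=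
    mul_nonneg (by norm_num) (tsum_nonneg fun l => mul_nonneg (h.mass_pos l).le (sq_nonneg _))
  have e : ∀ j, (‖x‖⁻¹ • x) j = x j / ‖x‖ := fun j => by
    simp [div_eq_inv_mul]
  simp only [e] at h1
  exact h1.trans (mul_le_of_le_one_right h0 h2)

theorem tsum_mul_nu_sq_le (h : IsLocalizedBL m p lam δ ε₀ C g) {k : ℕ} {x : E3}
    (hx : ∀ l, l ≠ k → ‖lam • p k - lam • p l‖ ≤ 3 * ‖x - lam • p l‖) :
    ∑' l, m l * nu (x - lam • p l) ^ 2 ≤ m k + 3 * δ k :=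
  ((summable_mul_nu_sq (fun l => (h.mass_pos l).le) (h.summable_mul_nu x)).tsum_le_tsum
    (fun l => mul_le_mul_of_nonneg_left (nu_sq_le_nu _) (h.mass_pos l).le)
    (h.summable_mul_nu x)).trans (h.tsum_mul_nu_le hx)

end IsLocalizedBL

/-! ### Finite total mass: Gauss's law and the limit of the flux -/

theorem sphereIntegral_sub {F G : E3 → ℝ} (hF : ContinuousOn F {0}ᶜ) (hG : ContinuousOn G {0}ᶜ)
    {r : ℝ} (hr : 0 < r) :
    sphereIntegral r (fun x => F x - G x) = sphereIntegral r F - sphereIntegral r G := by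
  rw [sphereIntegral, integral_sub (integrable_sphere_of_continuousOn hF hr)
    (integrable_sphere_of_continuousOn hG hr), mul_sub, sphereIntegral, sphereIntegral]

theorem continuousOn_div_norm (j : Fin 3) : ContinuousOn (fun x : E3 => x j / ‖x‖) {0}ᶜ :=
  ContinuousOn.div (by fun_prop) continuous_norm.continuousOn fun _ hx => norm_ne_zero_iff.2 hx

theorem continuousOn_sum_mul_div_norm {X : Fin 3 → E3 → ℝ} (hX : ∀ j, Continuous (X j)) :
    ContinuousOn (fun x : E3 => ∑ j, X j x * (x j / ‖x‖)) {0}ᶜ :=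
  continuousOn_finsetSum _ fun j _ => (hX j).continuousOn.mul (continuousOn_div_norm j)

theorem summable_mul_nu_of_summable_mass {m : ℕ → ℝ} (hm : ∀ l, 0 ≤ m l) (hmS : Summable m)
    (c : ℕ → E3) (x : E3) : Summable fun l => m l * nu (x - c l) :=
  hmS.of_nonneg_of_le (fun l => mul_nonneg (hm l) (nu_pos _).le) fun l =>
    mul_le_of_le_one_right (hm l) (nu_le_one _)

theorem continuous_newtonField_sub (j : Fin 3) (c : E3) :
    Continuous fun x => newtonField j (x - c) :=
  (contDiff_newtonField j).continuous.comp (by fun_prop)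

theorem continuous_regGrad {m : ℕ → ℝ} (hm : ∀ l, 0 ≤ m l) (hmS : Summable m) (c : ℕ → E3)
    (j : Fin 3) : Continuous (regGrad m c j) := by
  refine continuous_tsum (fun l => continuous_const.mul (continuous_newtonField_sub j (c l)))
    (hmS.mul_left (5 / 2)) fun l x => (abs_mul_newtonField_le hm j x l).trans ?_
  have := mul_le_of_le_one_right (hm l) (pow_le_one₀ (n := 2) (nu_pos (x - c l)).le (nu_le_one _))
  linarith

theorem norm_inv_norm_smul_le (x : E3) : ‖‖x‖⁻¹ • x‖ ≤ 1 := by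
  rw [norm_smul, norm_inv, norm_norm]
  exact inv_mul_le_one

theorem inv_norm_smul_apply (x : E3) (j : Fin 3) : (‖x‖⁻¹ • x) j = x j / ‖x‖ := by
  simp [div_eq_inv_mul]

/-- Gauss's law for the regularized potential. -/
theorem sphereIntegral_regGrad {m : ℕ → ℝ} (hm : ∀ l, 0 ≤ m l) (hmS : Summable m) (c : ℕ → E3)
    {r : ℝ} (hr : 0 < r) :
    sphereIntegral r (fun x => -8 * ∑ j, regGrad m c j x * (x j / ‖x‖)) =
      ∑' l, 4 * m l * ∫ x in Metric.ball (0 : E3) r, newtonDensity (x - c l) := by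
  have e : (fun x : E3 => -8 * ∑ j, regGrad m c j x * (x j / ‖x‖)) = fun x : E3 =>
      ∑' l, 4 * m l * ∑ j, -newtonField j (x - c l) * (x j / ‖x‖) := by
    funext x
    have h1 := sum_regGrad_mul hm (summable_mul_nu_of_summable_mass hm hmS c x) (‖x‖⁻¹ • x)
    simp only [inv_norm_smul_apply] at h1
    rw [h1, ← tsum_mul_left]
    refine tsum_congr fun l => ?_
    simp only [neg_mul, Finset.sum_neg_distrib]
    ring
  have hcont : ∀ l, ContinuousOn
      (fun x : E3 => 4 * m l * ∑ j, -newtonField j (x - c l) * (x j / ‖x‖)) {0}ᶜ := fun l =>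
    continuousOn_const.mul (continuousOn_sum_mul_div_norm
      (X := fun j x => -newtonField j (x - c l)) fun j => (continuous_newtonField_sub j (c l)).neg)
  rw [e, sphereIntegral_tsum hcont (hmS.mul_left 20) (fun l x => ?_) hr]
  · refine tsum_congr fun l => ?_
    rw [← sphereFlux_newtonField hr, sphereFlux, sphereIntegral_const_mul]
  · have h1 := abs_sum_newtonField_mul_le (x - c l) (‖x‖⁻¹ • x)
    simp only [inv_norm_smul_apply] at h1
    simp only [neg_mul, Finset.sum_neg_distrib]
    rw [abs_mul, abs_neg, abs_of_nonneg (by linarith [hm l])]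
    have h2 : 5 * nu (x - c l) ^ 2 * ‖‖x‖⁻¹ • x‖ ≤ 5 * 1 * 1 := by
      gcongr
      · exact pow_le_one₀ (nu_pos _).le (nu_le_one _)
      · exact norm_inv_norm_smul_le x
    have := mul_le_mul_of_nonneg_left (h1.trans h2) (hm l)
    linarith

/-- Each center's bump is eventually enclosed and then contributes exactly 4 m_l · 4π, which also
dominates its contribution at every radius. -/
theorem tendsto_sphereIntegral_regGrad {m : ℕ → ℝ} (hm : ∀ l, 0 ≤ m l) (hmS : Summable m)
    (c : ℕ → E3) :
    Tendsto (fun r => sphereIntegral r fun x => -8 * ∑ j, regGrad m c j x * (x j / ‖x‖)) atTop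
      (𝓝 (16 * Real.pi * ∑' l, m l)) := by
  have h1 : Tendsto (fun r => ∑' l, 4 * m l * ∫ x in Metric.ball (0 : E3) r,
      newtonDensity (x - c l)) atTop (𝓝 (∑' l, 4 * m l * (4 * Real.pi))) := by
    refine tendsto_tsum_of_dominated_convergence
      (bound := fun l => 4 * m l * (4 * Real.pi)) ((hmS.mul_left 4).mul_right _) (fun l => ?_)
      (.of_forall fun r l => ?_)
    · refine tendsto_const_nhds.congr' ?_
      filter_upwards [eventually_ge_atTop (‖c l‖ + 2)] with r hr
      rw [setIntegral_ball_newtonDensity_sub hr, integral_newtonDensity]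
    · rw [Real.norm_of_nonneg (mul_nonneg (by linarith [hm l])
        (setIntegral_ball_newtonDensity_sub_nonneg _ _))]
      refine mul_le_mul_of_nonneg_left ?_ (by linarith [hm l])
      rw [← integral_newtonDensity, ← integral_sub_right_eq_self newtonDensity (c l)]
      exact setIntegral_le_integral (integrable_newtonDensity.comp_sub_right (c l))
        (.of_forall fun x => newtonDensity_nonneg _)
  have h2 : ∑' l, 4 * m l * (4 * Real.pi) = 16 * Real.pi * ∑' l, m l := by
    rw [← tsum_mul_left]
    exact tsum_congr fun l => by ring
  rw [← h2]
  refine h1.congr' ?_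
  filter_upwards [eventually_gt_atTop 0] with r hr
  rw [sphereIntegral_regGrad hm hmS c hr]

theorem sq_mul_le_add_pow_three {a b : ℝ} (ha : 0 ≤ a) (hb : 0 ≤ b) :
    a ^ 2 * b ≤ a ^ 3 + b ^ 3 := by
  rcases le_total b a with h | h
  · nlinarith [mul_le_mul_of_nonneg_left h (sq_nonneg a), pow_nonneg hb 3]
  · have : a ^ 2 * b ≤ b ^ 2 * b := by gcongr
    nlinarith [pow_nonneg ha 3]

/-- Expand into the double sum of m_l m_k a_l² a_k and use a²b ≤ a³ + b³. The product of gradient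
and potential is thereby controlled by cubes of ν, the power whose sphere integrals are uniformly
bounded. -/
theorem tsum_mul_sq_mul_tsum_mul_le {m a : ℕ → ℝ} (hm : ∀ l, 0 ≤ m l) (hmS : Summable m)
    (ha : ∀ l, 0 ≤ a l) (ha1 : ∀ l, a l ≤ 1) :
    (∑' l, m l * a l ^ 2) * ∑' l, m l * a l ≤ 2 * (∑' l, m l) * ∑' l, m l * a l ^ 3 := by
  have hs : ∀ n : ℕ, Summable fun l => m l * a l ^ n := fun n =>
    hmS.of_nonneg_of_le (fun l => mul_nonneg (hm l) (pow_nonneg (ha l) n)) fun l =>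
      mul_le_of_le_one_right (hm l) (pow_le_one₀ (ha l) (ha1 l))
  have hs1 : Summable fun l => m l * a l := by simpa using hs 1
  set S := ∑' l, m l * a l ^ 3
  set M := ∑' l, m l
  have h1 : ∀ l, a l ^ 2 * ∑' k, m k * a k ≤ M * a l ^ 3 + S := fun l => by
    rw [← tsum_mul_left, ← tsum_mul_right, ← (hmS.mul_right _).tsum_add (hs 3)]
    refine (hs1.mul_left _).tsum_le_tsum (fun k => ?_) ((hmS.mul_right _).add (hs 3))
    have := mul_le_mul_of_nonneg_left (sq_mul_le_add_pow_three (ha l) (ha k)) (hm k)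
    linarith
  rw [← tsum_mul_right]
  calc ∑' l, m l * a l ^ 2 * ∑' k, m k * a k ≤ ∑' l, (M * (m l * a l ^ 3) + m l * S) := by
        refine ((hs 2).mul_right _).tsum_le_tsum (fun l => ?_)
          (((hs 3).mul_left _).add (hmS.mul_right _))
        have := mul_le_mul_of_nonneg_left (h1 l) (hm l)
        linarith
    _ = 2 * M * S := by
        rw [((hs 3).mul_left _).tsum_add (hmS.mul_right _), tsum_mul_left, tsum_mul_right]
        ring

namespace IsLocalizedBL

variable {m : ℕ → ℝ} {p : ℕ → E3} {lam : ℝ} {δ : ℕ → ℝ} {ε₀ C : ℝ} {g : TensorField}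

/-- With R = ∂_r U the difference is 8R(U - 1)/U, a product of gradient and potential; 60 = 8 ·
(5/2) · (3/2) · 2. -/
theorem abs_admIntegrand_sub_le_outside (h : IsLocalizedBL m p lam δ ε₀ C g) (hmS : Summable m)
    {x : E3} (hx : ∀ k, 2 < ‖x - lam • p k‖) :
    |admIntegrand g x - -8 * ∑ j, regGrad m (fun k => lam • p k) j x * (x j / ‖x‖)| ≤
      60 * (∑' l, m l) * ∑' l, m l * nu (x - lam • p l) ^ 3 := by
  rw [h.admIntegrand_outside hx]
  set R := ∑ j, regGrad m (fun k => lam • p k) j x * (x j / ‖x‖)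
  set U := regFactor m (fun k => lam • p k) x
  have hU : 1 ≤ U := h.one_le_regFactor x
  have hU0 : 0 < U := by linarith
  have e : -8 * R / U - -8 * R = 8 * R * ((U - 1) / U) := by
    field_simp
    ring
  have h1 : |(U - 1) / U| ≤ U - 1 := by
    rw [abs_of_nonneg (div_nonneg (by linarith) hU0.le)]
    exact div_le_self (by linarith) hU
  have h2 : U - 1 ≤ 3 / 2 * ∑' l, m l * nu (x - lam • p l) :=
    regFactor_sub_one_le (fun l => (h.mass_pos l).le) (h.summable_mul_nu x)
  have h3 : |R| ≤ 5 / 2 * ∑' l, m l * nu (x - lam • p l) ^ 2 := h.abs_regGrad_radial_le x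
  have h4 := tsum_mul_sq_mul_tsum_mul_le (fun l => (h.mass_pos l).le) hmS
    (fun l => (nu_pos (x - lam • p l)).le) fun l => nu_le_one _
  rw [e, abs_mul, abs_mul, abs_of_nonneg (show (0 : ℝ) ≤ 8 by norm_num)]
  calc 8 * |R| * |(U - 1) / U|
      ≤ 8 * (5 / 2 * ∑' l, m l * nu (x - lam • p l) ^ 2) *
        (3 / 2 * ∑' l, m l * nu (x - lam • p l)) :=
        mul_le_mul (by linarith) (h1.trans h2) (abs_nonneg _)
          (mul_nonneg (by norm_num) ((abs_nonneg _).trans h3))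
    _ ≤ _ := by linarith

theorem almost_nearest_of_norm_le_two (h : IsLocalizedBL m p lam δ ε₀ C g) {k : ℕ} {x : E3}
    (hx : ‖x - lam • p k‖ ≤ 2) (l : ℕ) (hl : l ≠ k) :
    ‖lam • p k - lam • p l‖ ≤ 3 * ‖x - lam • p l‖ :=
  (h.almost_nearest_of_norm_le (hx.trans (by norm_num)) hl).1

/-- If C m_k ≤ 1/6 the metric is at least half the Euclidean one, so both integrands are of order
m_k + δ_k. On the ball 27ν³ ≥ 1, which puts the bound in the form required by the cubic error
estimate. -/
theorem abs_admIntegrand_sub_le_inside (h : IsLocalizedBL m p lam δ ε₀ C g) {k : ℕ} {x : E3}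
    (hx : ‖x - lam • p k‖ ≤ 2) (hk : C * m k ≤ 1 / 6) :
    |admIntegrand g x - -8 * ∑ j, regGrad m (fun k => lam • p k) j x * (x j / ‖x‖)| ≤
      (108 * C + 60) * (m k + δ k) * (27 * nu (x - lam • p k) ^ 3) := by
  have h1 := h.abs_admIntegrand_inside_le hx one_half_pos
    (half_norm_sq_le fun i j => (h.abs_sub_one_le hx i j).trans hk)
  have h2 := h.abs_regGrad_radial_le x
  have h3 := h.tsum_mul_nu_sq_le (h.almost_nearest_of_norm_le_two hx)
  have h4 : 1 ≤ 27 * nu (x - lam • p k) ^ 3 := by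
    have := one_le_pow₀ (n := 3) (one_le_three_mul_nu hx)
    linarith
  set R := ∑ j, regGrad m (fun k => lam • p k) j x * (x j / ‖x‖)
  have h5 : |admIntegrand g x - -8 * R| ≤ |admIntegrand g x| + 8 * |R| := by
    refine (abs_sub _ _).trans_eq ?_
    rw [abs_mul, abs_neg, abs_of_pos (show (0 : ℝ) < 8 by norm_num)]
  have hm := h.mass_pos k
  have hδ := h.delta_pos k
  have hC := h.const_pos
  have h6 : |admIntegrand g x - -8 * R| ≤ (108 * C + 60) * (m k + δ k) := by
    have : 0 < C * δ k := mul_pos hC hδ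
    have e : 54 * C / (1 / 2) * m k = 108 * (C * m k) := by ring
    nlinarith
  exact h6.trans (le_mul_of_one_le_right (by positivity) h4)

/-- With finite total mass the flux converges to `16π` times the total mass. -/
theorem tendsto_admFlux (h : IsLocalizedBL m p lam δ ε₀ C g) (hδ : Summable δ)
    (hmS : Summable m) : Tendsto (admFlux g) atTop (𝓝 (16 * Real.pi * ∑' k, m k)) := by
  set c : ℕ → E3 := fun k => lam • p k with hc
  have hm : ∀ l, 0 ≤ m l := fun l => (h.mass_pos l).le
  set N : E3 → ℝ := fun x => -8 * ∑ j, regGrad m c j x * (x j / ‖x‖) with hN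
  have hNc : ContinuousOn N {0}ᶜ :=
    continuousOn_const.mul (continuousOn_sum_mul_div_norm fun j => continuous_regGrad hm hmS c j)
  -- Only finitely many masses violate C m_k ≤ 1/6, and large spheres miss their balls.
  have hsmall : ∀ᶠ r : ℝ in atTop, ∀ k, ¬C * m k ≤ 1 / 6 → ‖c k‖ + 2 < r := by
    have h1 : ∀ᶠ k in cofinite, C * m k ≤ 1 / 6 := by
      have := hmS.tendsto_cofinite_zero.const_mul C
      rw [mul_zero] at this
      exact this.eventually_le_const (by norm_num)
    have h2 := (eventually_cofinite.1 h1)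
    exact (eventually_all_finite h2).2 fun k _ => eventually_gt_atTop _
  set M := ∑' l, m l
  have hM : 0 ≤ M := tsum_nonneg hm
  set K := 27 * (108 * C + 60) with hK
  have hK0 : 0 ≤ K := by have := h.const_pos; positivity
  -- One summable weight covers both the error off the balls and the error on them.
  set w : ℕ → ℝ := fun l => 60 * M * m l + K * (m l + δ l) with hw
  have hwS : Summable w := (hmS.mul_left _).add ((hmS.add hδ).mul_left K)
  have hw1 : ∀ l, 60 * M * m l ≤ w l := fun l =>
    le_add_of_nonneg_right (mul_nonneg hK0 (add_nonneg (hm l) (h.delta_pos l).le))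
  have hw2 : ∀ l, K * (m l + δ l) ≤ w l := fun l =>
    le_add_of_nonneg_left (mul_nonneg (by positivity) (hm l))
  have hw0 : ∀ l, 0 ≤ w l := fun l => (mul_nonneg (by positivity) (hm l)).trans (hw1 l)
  have hdiff : Tendsto (fun r => sphereIntegral r fun x => admIntegrand g x - N x) atTop (𝓝 0) := by
    refine tendsto_sphereIntegral_of_abs_le_tsum hwS hw0 c
      (H := fun _ x => admIntegrand g x - N x) ?_
    filter_upwards [hsmall] with r hr x hx
    have hsum := summable_mul_nu_pow_three hwS hw0 c x
    by_cases hk : ∃ k, ‖x - c k‖ ≤ 2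
    · obtain ⟨k, hk⟩ := hk
      have hCk : C * m k ≤ 1 / 6 := by
        by_contra hcon
        have := hr k hcon
        have h2 := norm_sub_norm_le x (c k)
        linarith
      refine (h.abs_admIntegrand_sub_le_inside hk hCk).trans ?_
      refine le_trans (le_trans (le_of_eq ?_)
        (mul_le_mul_of_nonneg_right (hw2 k) (pow_pos (nu_pos (x - c k)) 3).le))
        (hsum.le_tsum k fun l _ => mul_nonneg (hw0 l) (pow_pos (nu_pos _) 3).le)
      rw [hK]
      ring
    · push Not at hk
      refine (h.abs_admIntegrand_sub_le_outside hmS hk).trans ?_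
      rw [← tsum_mul_left]
      refine ((summable_mul_nu_pow_three hmS hm c x).mul_left _).tsum_le_tsum (fun l => ?_) hsum
      rw [← mul_assoc]
      exact mul_le_mul_of_nonneg_right (hw1 l) (pow_pos (nu_pos _) 3).le
  have := hdiff.add (tendsto_sphereIntegral_regGrad hm hmS c)
  rw [zero_add] at this
  refine this.congr' ?_
  filter_upwards [eventually_gt_atTop 0] with r hr
  rw [sphereIntegral_sub h.metric.continuousOn_admIntegrand hNc hr, sub_add_cancel]
  rfl

end IsLocalizedBL

/-! ### Counting centers; asymptotic flatness forces finite mass -/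

theorem ball_inter_sphere_nonempty {c : E3} {ρ : ℝ} (hρ : 0 < ρ) (h : |‖c‖ - ρ| < 2) :
    (Metric.ball c 2 ∩ Metric.sphere (0 : E3) ρ).Nonempty := by
  rcases eq_or_ne c 0 with rfl | hc
  · refine ⟨ρ • EuclideanSpace.single 0 1, ?_, ?_⟩ <;>
      simp_all [norm_smul, abs_of_pos]
  · have hn : ‖c‖ ≠ 0 := norm_ne_zero_iff.2 hc
    refine ⟨(ρ / ‖c‖) • c, ?_, ?_⟩
    · have e : (ρ / ‖c‖) • c - c = ((ρ - ‖c‖) / ‖c‖) • c := by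
        rw [sub_div, div_self hn, sub_smul, one_smul]
      rw [mem_ball_iff_norm, e, norm_smul, norm_div, norm_norm, div_mul_cancel₀ _ hn,
        Real.norm_eq_abs, abs_sub_comm]
      exact h
    · rw [mem_sphere_zero_iff_norm, norm_smul, norm_div, norm_norm, div_mul_cancel₀ _ hn,
        Real.norm_of_nonneg hρ.le]

theorem BoundedlyManyMeet.exists_encard_le {c : ℕ → E3}
    (h : BoundedlyManyMeet c fun _ => 2) :
    ∃ N : ℕ, ∀ r : ℝ, 0 < r → {k : ℕ | |‖c k‖ - r| < 2}.encard ≤ N := by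
  obtain ⟨N, hN⟩ := h
  exact ⟨N, fun r hr => (Set.encard_le_encard fun k hk =>
    ball_inter_sphere_nonempty hr hk).trans (hN r hr)⟩

theorem encard_floor_fiber_le {c : ℕ → E3} {N : ℕ}
    (hN : ∀ r : ℝ, 0 < r → {k : ℕ | |‖c k‖ - r| < 2}.encard ≤ N) (n : ℕ) :
    {k : ℕ | ⌊‖c k‖⌋₊ = n}.encard ≤ N := by
  -- The radius n + 1 rather than n stays positive for n = 0.
  refine (Set.encard_le_encard fun k hk => ?_).trans (hN (n + 1) (by positivity))
  have hk' : ⌊‖c k‖⌋₊ = n := hk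
  have h1 := Nat.floor_le (norm_nonneg (c k))
  have h2 := Nat.lt_floor_add_one ‖c k‖
  rw [hk'] at h1 h2
  change |‖c k‖ - (n + 1)| < 2
  rw [abs_lt]
  constructor <;> linarith

/-- At most `N` centers lie in each unit shell, so the sum is at most `N` times the sum of `f`. -/
theorem summable_comp_floor_norm {c : ℕ → E3} {N : ℕ}
    (hN : ∀ r : ℝ, 0 < r → {k : ℕ | |‖c k‖ - r| < 2}.encard ≤ N) {f : ℕ → ℝ} (hf : Summable f)
    (hf0 : ∀ n, 0 ≤ f n) : Summable fun k => f ⌊‖c k‖⌋₊ := by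
  refine summable_of_sum_le (c := ∑' n, N * f n) (fun k => hf0 _) fun s => ?_
  rw [Finset.sum_comp f fun k => ⌊‖c k‖⌋₊]
  refine (Finset.sum_le_sum fun n _ => ?_).trans
    ((hf.mul_left (N : ℝ)).sum_le_tsum _ fun n _ => mul_nonneg N.cast_nonneg (hf0 n))
  rw [nsmul_eq_mul]
  refine mul_le_mul_of_nonneg_right ?_ (hf0 n)
  have h1 : ((s.filter fun k => ⌊‖c k‖⌋₊ = n : Finset ℕ) : Set ℕ).encard ≤ N :=
    (Set.encard_le_encard fun k hk => by simpa using (Finset.mem_filter.1 hk).2).trans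
      (encard_floor_fiber_le hN n)
  rw [Set.encard_coe_eq_coe_finsetCard] at h1
  exact_mod_cast h1

theorem tendsto_norm_cofinite_of_encard_le {c : ℕ → E3} {N : ℕ}
    (hN : ∀ r : ℝ, 0 < r → {k : ℕ | |‖c k‖ - r| < 2}.encard ≤ N) :
    Tendsto (fun k => ‖c k‖) cofinite atTop := by
  have h1 : Tendsto (fun k => ⌊‖c k‖⌋₊) cofinite atTop := by
    rw [← Nat.cofinite_eq_atTop]
    refine Tendsto.cofinite_of_finite_preimage_singleton fun n => ?_
    exact Set.finite_of_encard_le_coe (encard_floor_fiber_le hN n)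
  exact tendsto_atTop_mono (fun k => Nat.floor_le (norm_nonneg _))
    (tendsto_natCast_atTop_atTop.comp h1)

theorem summable_half_rpow {τ : ℝ} (hτ : 0 < τ) :
    Summable fun n : ℕ => (((n : ℝ) + 1) / 2) ^ (-τ - 1) := by
  have h1 : Summable fun n : ℕ => (n : ℝ) ^ (-τ - 1) := Real.summable_nat_rpow.2 (by linarith)
  have h2 := ((summable_nat_add_iff 1).2 h1).div_const ((2 : ℝ) ^ (-τ - 1))
  refine h2.congr fun n => ?_
  rw [Real.div_rpow (by positivity) zero_le_two]
  push_cast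
  rfl

namespace IsLocalizedBL

variable {m : ℕ → ℝ} {p : ℕ → E3} {lam : ℝ} {δ : ℕ → ℝ} {ε₀ C : ℝ} {g : TensorField}

/-- Near its center each mass is controlled by the first derivatives of the metric and by the
interaction with the other masses. -/
theorem mass_le_abs_pderiv (h : IsLocalizedBL m p lam δ ε₀ C g) (k : ℕ) :
    2 / 25 * m k ≤
      |pderiv 0 (fun y => g y 0 0) (lam • p k + (5 / 2 : ℝ) • EuclideanSpace.single 0 1)| +
        15 / 2 * δ k := by
  -- At distance 5/2 from c_k the point is off every closed ball of radius 2, so g is conformally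
  -- flat near it and its derivative is 4U³ ∂U with U ≥ 1.
  set x : E3 := lam • p k + (5 / 2 : ℝ) • EuclideanSpace.single 0 1 with hx
  have hm : ∀ l, 0 ≤ m l := fun l => (h.mass_pos l).le
  have hxk : x - lam • p k = (5 / 2 : ℝ) • EuclideanSpace.single 0 1 := by rw [hx]; abel
  have hnorm : ‖x - lam • p k‖ = 5 / 2 := by
    rw [hxk, norm_smul]
    norm_num
  have hnear : ∀ l, l ≠ k → ‖lam • p k - lam • p l‖ ≤ 3 * ‖x - lam • p l‖ :=
    fun l hl => (h.almost_nearest_of_norm_le hnorm.le hl).1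
  have hout : ∀ l, 2 < ‖x - lam • p l‖ := fun l => by
    rcases eq_or_ne l k with rfl | hl
    · rw [hnorm]; norm_num
    · linarith [(h.almost_nearest_of_norm_le hnorm.le hl).2]
  have hU := h.one_le_regFactor x
  have e1 : pderiv 0 (fun y => g y 0 0) x = 4 * regFactor m (fun k => lam • p k) x ^ 3 *
      regGrad m (fun k => lam • p k) 0 x := by
    rw [pderiv_conformal (h.hasFDerivAt_regFactor x) (h.eventually_eq_regFactor hout),
      h.pderiv_regFactor, Matrix.one_apply_eq, one_mul]
  have h1 : |regGrad m (fun k => lam • p k) 0 x| ≤ |pderiv 0 (fun y => g y 0 0) x| := by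
    rw [e1, abs_mul]
    refine le_mul_of_one_le_left (abs_nonneg _) ?_
    have := one_le_pow₀ (n := 3) hU
    exact le_trans (by linarith) (le_abs_self _)
  -- The Newtonian field has size (5/2)⁻² = 4/25 here; multiplying by m_k/2 gives the coefficient
  -- 2/25.
  have h2 : newtonField 0 (x - lam • p k) = -(4 / 25) := by
    rw [newtonField, newtonSlope_of_two_le (by rw [hnorm]; norm_num), hnorm, hxk]
    simp
    norm_num
  have h3 : regGrad m (fun k => lam • p k) 0 x = -(2 / 25 * m k) +
      ∑' l : {l // l ≠ k}, m l / 2 * newtonField 0 (x - lam • p l) := by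
    rw [regGrad, tsum_eq_add_tsum_ne (summable_mul_newtonField hm (h.summable_mul_nu x) 0) k, h2]
    ring
  have h4 : |∑' l : {l // l ≠ k}, m l / 2 * newtonField 0 (x - lam • p l)| ≤ 15 / 2 * δ k := by
    have hs : Summable fun l : {l // l ≠ k} => 5 / 2 * (m l * nu (x - lam • p l)) :=
      ((h.summable_mul_nu x).subtype _).mul_left (5 / 2)
    have hb : ∀ l : {l // l ≠ k}, ‖m l / 2 * newtonField 0 (x - lam • p l)‖ ≤
        5 / 2 * (m l * nu (x - lam • p l)) := fun l => by
      refine (abs_mul_newtonField_le (c := fun l => lam • p l) hm 0 x l).trans ?_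
      have := mul_le_mul_of_nonneg_left (nu_sq_le_nu (x - lam • p l)) (hm l)
      linarith
    have h4 := tsum_of_norm_bounded hs.hasSum hb
    rw [tsum_mul_left, Real.norm_eq_abs] at h4
    linarith [h.tsum_ne_mul_nu_le hnear]
  have h5 := neg_le_abs (regGrad m (fun k => lam • p k) 0 x)
  have h6 := le_abs_self (∑' l : {l // l ≠ k}, m l / 2 * newtonField 0 (x - lam • p l))
  linarith

/-- An asymptotically flat metric has finite total mass. -/
theorem summable_mass_of_isAsymptoticallyFlat (h : IsLocalizedBL m p lam δ ε₀ C g)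
    (hδ : Summable δ) (hb : BoundedlyManyMeet (fun k => lam • p k) fun _ => 2)
    (hAF : IsAsymptoticallyFlat g) : Summable m := by
  obtain ⟨N, hN⟩ := hb.exists_encard_le
  obtain ⟨τ, hτ, hg⟩ := hAF
  set v : E3 := (5 / 2 : ℝ) • EuclideanSpace.single 0 1 with hv
  have hvn : ‖v‖ = 5 / 2 := by
    rw [hv, norm_smul]
    norm_num
  have hc := tendsto_norm_cofinite_of_encard_le hN
  have hge : ∀ k, ‖lam • p k‖ - 5 / 2 ≤ ‖lam • p k + v‖ := fun k => by
    have := norm_sub_le (lam • p k + v) v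
    rw [add_sub_cancel_right] at this
    linarith
  have hx : Tendsto (fun k => lam • p k + v) cofinite (cocompact E3) := by
    rw [← Metric.cobounded_eq_cocompact, ← tendsto_norm_atTop_iff_cobounded]
    exact tendsto_atTop_mono hge (tendsto_atTop_add_const_right _ _ hc)
  have hO := ((hg 0 0).2 0).comp_tendsto hx
  have hO2 : (fun k => ‖lam • p k + v‖ ^ (-τ - 1)) =O[cofinite]
      fun k => (((⌊‖lam • p k‖⌋₊ : ℝ) + 1) / 2) ^ (-τ - 1) := by
    refine Asymptotics.IsBigO.of_bound 1 ?_
    -- From |c_k| ≥ 6 on, |c_k| - 5/2 ≥ (|c_k| + 1)/2.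
    filter_upwards [hc.eventually_ge_atTop 6] with k hk
    have hfl := Nat.floor_le (norm_nonneg (lam • p k))
    rw [one_mul, Real.norm_of_nonneg (Real.rpow_nonneg (norm_nonneg _) _),
      Real.norm_of_nonneg (Real.rpow_nonneg (by positivity) _)]
    exact Real.rpow_le_rpow_of_nonpos (by positivity) (by linarith [hge k]) (by linarith)
  have hsum : Summable fun k => (((⌊‖lam • p k‖⌋₊ : ℝ) + 1) / 2) ^ (-τ - 1) :=
    summable_comp_floor_norm hN (summable_half_rpow (by linarith))
      fun n => Real.rpow_nonneg (by positivity) _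
  have hd : Summable fun k => pderiv 0 (fun y => g y 0 0) (lam • p k + v) :=
    summable_of_isBigO hsum (hO.trans hO2)
  refine (((hd.abs.add (hδ.mul_left (15 / 2))).mul_left (25 / 2))).of_nonneg_of_le
    (fun k => (h.mass_pos k).le) fun k => ?_
  linarith [h.mass_le_abs_pderiv k]

end IsLocalizedBL

/-! ### Infinite total mass: divergence of the flux -/

/-- Partial sums of `regFactor`. -/
noncomputable def partialFactor (m : ℕ → ℝ) (c : ℕ → E3) (L : ℕ) (x : E3) : ℝ :=
  1 + ∑ l ∈ Finset.range L, m l / 2 * newtonKernel (x - c l)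

/-- Partial sums of `regGrad`. -/
noncomputable def partialGrad (m : ℕ → ℝ) (c : ℕ → E3) (L : ℕ) (j : Fin 3) (x : E3) : ℝ :=
  ∑ l ∈ Finset.range L, m l / 2 * newtonField j (x - c l)

theorem contDiff_partialFactor (m : ℕ → ℝ) (c : ℕ → E3) (L : ℕ) :
    ContDiff ℝ 1 (partialFactor m c L) :=
  contDiff_const.add <| ContDiff.sum fun _ _ => contDiff_const.mul
    (contDiff_newtonKernel.comp (contDiff_id.sub contDiff_const))

theorem contDiff_partialGrad (m : ℕ → ℝ) (c : ℕ → E3) (L : ℕ) (j : Fin 3) :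
    ContDiff ℝ 1 (partialGrad m c L j) :=
  ContDiff.sum fun _ _ => contDiff_const.mul
    ((contDiff_newtonField j).comp (contDiff_id.sub contDiff_const))

theorem pderiv_const_add_sum_mul_comp_sub {f : E3 → ℝ} (hf : Differentiable ℝ f) (s : Finset ℕ)
    (a : ℝ) (w : ℕ → ℝ) (c : ℕ → E3) (j : Fin 3) (x : E3) :
    pderiv j (fun x => a + ∑ l ∈ s, w l * f (x - c l)) x =
      ∑ l ∈ s, w l * pderiv j f (x - c l) := by
  have h1 : ∀ l, HasFDerivAt (fun x => f (x - c l)) (fderiv ℝ f (x - c l)) x := fun l =>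
    (hf (x - c l)).hasFDerivAt.comp x (f := fun y : E3 => y - c l)
      ((hasFDerivAt_id x).sub_const (c l))
  rw [pderiv_of_hasFDerivAt
    ((HasFDerivAt.fun_sum fun l (_ : l ∈ s) => (h1 l).const_mul (w l)).const_add a)]
  simp [pderiv]

theorem pderiv_partialFactor (m : ℕ → ℝ) (c : ℕ → E3) (L : ℕ) (j : Fin 3) (x : E3) :
    pderiv j (partialFactor m c L) x = partialGrad m c L j x := by
  have := pderiv_const_add_sum_mul_comp_sub (contDiff_newtonKernel.differentiable one_ne_zero)
    (Finset.range L) 1 (fun l => m l / 2) c j x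
  simp only [pderiv_newtonKernel] at this
  exact this

theorem sum_pderiv_partialGrad (m : ℕ → ℝ) (c : ℕ → E3) (L : ℕ) (x : E3) :
    ∑ j, pderiv j (partialGrad m c L j) x =
      -∑ l ∈ Finset.range L, m l / 2 * newtonDensity (x - c l) := by
  have h1 : ∀ j, pderiv j (partialGrad m c L j) x =
      ∑ l ∈ Finset.range L, m l / 2 * pderiv j (newtonField j) (x - c l) := fun j => by
    have := pderiv_const_add_sum_mul_comp_sub
      ((contDiff_newtonField j).differentiable one_ne_zero)
      (Finset.range L) 0 (fun l => m l / 2) c j x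
    simp only [zero_add] at this
    exact this
  simp only [h1]
  rw [Finset.sum_comm, ← Finset.sum_neg_distrib]
  refine Finset.sum_congr rfl fun l _ => ?_
  rw [← Finset.mul_sum, sum_pderiv_newtonField, mul_neg]

theorem pderiv_const_mul_div {f u : E3 → ℝ} {x : E3} (hf : DifferentiableAt ℝ f x)
    (hu : DifferentiableAt ℝ u x) (hux : u x ≠ 0) (a : ℝ) (j : Fin 3) :
    pderiv j (fun x => a * (f x / u x)) x =
      a * (pderiv j f x / u x) - a * (f x * pderiv j u x / u x ^ 2) := by
  have h1 := (hasDerivAt_inv hux).comp_hasFDerivAt x hu.hasFDerivAt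
  have h2 := ((hf.hasFDerivAt.mul h1).const_mul a)
  have e : (fun x => a * (f x / u x)) = fun y => a * (f * (Inv.inv ∘ u)) y := by
    funext y
    simp [div_eq_mul_inv]
  rw [e, pderiv_of_hasFDerivAt h2]
  simp [pderiv]
  field_simp
  ring

theorem one_le_partialFactor {m : ℕ → ℝ} (hm : ∀ l, 0 ≤ m l) (c : ℕ → E3) (L : ℕ) (x : E3) :
    1 ≤ partialFactor m c L x :=
  le_add_of_nonneg_right <| Finset.sum_nonneg fun l _ =>
    mul_nonneg (by linarith [hm l]) (newtonKernel_nonneg _)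

/-- The vector field `-8 ∇ log` of the partial sums of the regularized potential. -/
noncomputable def partialField (m : ℕ → ℝ) (c : ℕ → E3) (L : ℕ) (j : Fin 3) (x : E3) : ℝ :=
  -8 * (partialGrad m c L j x / partialFactor m c L x)

theorem contDiff_partialField {m : ℕ → ℝ} (hm : ∀ l, 0 ≤ m l) (c : ℕ → E3) (L : ℕ) (j : Fin 3) :
    ContDiff ℝ 1 (partialField m c L j) :=
  contDiff_const.mul ((contDiff_partialGrad m c L j).div (contDiff_partialFactor m c L)
    fun x => (zero_lt_one.trans_le (one_le_partialFactor hm c L x)).ne')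

/-- The divergence of -8 ∇U/U is -8 ΔU/U + 8 |∇U|²/U². The square is dropped; in the first term -ΔU
is half the weighted sum of densities and U ≤ K. -/
theorem le_sum_pderiv_partialField {m : ℕ → ℝ} (hm : ∀ l, 0 ≤ m l) (c : ℕ → E3) (L : ℕ) {K : ℝ}
    {x : E3} (hK : partialFactor m c L x ≤ K) :
    4 / K * ∑ l ∈ Finset.range L, m l * newtonDensity (x - c l) ≤
      ∑ j, pderiv j (partialField m c L j) x := by
  have hU := one_le_partialFactor hm c L x
  have hU0 : 0 < partialFactor m c L x := by linarith
  have h1 : ∀ j, pderiv j (partialField m c L j) x =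
      -8 / partialFactor m c L x * pderiv j (partialGrad m c L j) x +
        8 * (partialGrad m c L j x ^ 2 / partialFactor m c L x ^ 2) := fun j => by
    have := pderiv_const_mul_div (((contDiff_partialGrad m c L j).differentiable one_ne_zero) x)
      (((contDiff_partialFactor m c L).differentiable one_ne_zero) x) hU0.ne' (-8) j
    rw [pderiv_partialFactor] at this
    refine this.trans ?_
    ring
  have h2 : 0 ≤ ∑ l ∈ Finset.range L, m l * newtonDensity (x - c l) :=
    Finset.sum_nonneg fun l _ => mul_nonneg (hm l) (newtonDensity_nonneg _)
  simp only [h1, Finset.sum_add_distrib, ← Finset.mul_sum]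
  rw [sum_pderiv_partialGrad]
  have h3 : ∑ l ∈ Finset.range L, m l / 2 * newtonDensity (x - c l) =
      1 / 2 * ∑ l ∈ Finset.range L, m l * newtonDensity (x - c l) := by
    rw [Finset.mul_sum]
    exact Finset.sum_congr rfl fun l _ => by ring
  rw [h3]
  have h4 : 0 ≤ ∑ j, partialGrad m c L j x ^ 2 / partialFactor m c L x ^ 2 :=
    Finset.sum_nonneg fun j _ => by positivity
  have h5 : 4 / K * ∑ l ∈ Finset.range L, m l * newtonDensity (x - c l) ≤
      4 / partialFactor m c L x * ∑ l ∈ Finset.range L, m l * newtonDensity (x - c l) := by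
    gcongr
  refine h5.trans ?_
  have e : -8 / partialFactor m c L x *
      -(1 / 2 * ∑ l ∈ Finset.range L, m l * newtonDensity (x - c l)) =
      4 / partialFactor m c L x * ∑ l ∈ Finset.range L, m l * newtonDensity (x - c l) := by
    ring
  rw [e]
  linarith

/-- The flux of `partialField` is bounded below by the enclosed mass. -/
theorem le_sphereFlux_partialField {m : ℕ → ℝ} (hm : ∀ l, 0 ≤ m l) (c : ℕ → E3) {n L : ℕ}
    (hnL : n ≤ L) {K : ℝ} (hK : ∀ x, partialFactor m c L x ≤ K) {r : ℝ} (hr : 0 < r)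
    (hnr : ∀ l < n, ‖c l‖ + 2 ≤ r) :
    16 * Real.pi / K * ∑ l ∈ Finset.range n, m l ≤ sphereFlux (partialField m c L) r := by
  have hK0 : 0 < K := zero_lt_one.trans_le ((one_le_partialFactor hm c L 0).trans (hK 0))
  have hDi : ∀ l, IntegrableOn (fun x => m l * newtonDensity (x - c l))
      (Metric.ball (0 : E3) r) := fun l =>
    ((integrable_newtonDensity.comp_sub_right (c l)).const_mul (m l)).integrableOn
  have hsum : IntegrableOn (fun x => 4 / K * ∑ l ∈ Finset.range L, m l * newtonDensity (x - c l))
      (Metric.ball (0 : E3) r) := (integrable_finsetSum _ fun l _ => hDi l).const_mul _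
  have hdiv : Continuous fun x => ∑ j, pderiv j (partialField m c L j) x :=
    continuous_finsetSum _ fun j _ => continuous_pderiv (contDiff_partialField hm c L j) j
  rw [sphereFlux_eq_integral_ball (contDiff_partialField hm c L) hr]
  calc 16 * Real.pi / K * ∑ l ∈ Finset.range n, m l
      = 4 / K * ∑ l ∈ Finset.range n, m l * (4 * Real.pi) := by
        rw [← Finset.sum_mul]
        ring
    _ = 4 / K * ∑ l ∈ Finset.range n,
          m l * ∫ x in Metric.ball (0 : E3) r, newtonDensity (x - c l) := by
        congr 1
        refine Finset.sum_congr rfl fun l hl => ?_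
        rw [setIntegral_ball_newtonDensity_sub (hnr l (Finset.mem_range.1 hl)),
          integral_newtonDensity]
    -- The bumps with n ≤ l < L need not be enclosed, but their contributions are nonnegative.
    _ ≤ 4 / K * ∑ l ∈ Finset.range L,
          m l * ∫ x in Metric.ball (0 : E3) r, newtonDensity (x - c l) := by
        refine mul_le_mul_of_nonneg_left ?_ (by positivity)
        exact Finset.sum_le_sum_of_subset_of_nonneg (Finset.range_mono hnL) fun l _ _ =>
          mul_nonneg (hm l) (setIntegral_ball_newtonDensity_sub_nonneg _ _)
    _ = ∫ x in Metric.ball (0 : E3) r,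
          4 / K * ∑ l ∈ Finset.range L, m l * newtonDensity (x - c l) := by
        rw [integral_const_mul, integral_finsetSum _ fun l _ => hDi l]
        simp only [integral_const_mul]
    _ ≤ _ := setIntegral_mono hsum ((hdiv.continuousOn.integrableOn_compact
        (isCompact_closedBall (0 : E3) r)).mono_set Metric.ball_subset_closedBall)
        fun x => le_sum_pderiv_partialField hm c L (hK x)

theorem partialFactor_le_regFactor {m : ℕ → ℝ} {c : ℕ → E3} (hm : ∀ l, 0 ≤ m l) {x : E3}
    (hS : Summable fun l => m l * nu (x - c l)) (L : ℕ) :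
    partialFactor m c L x ≤ regFactor m c x :=
  add_le_add_right ((summable_mul_newtonKernel hm hS).sum_le_tsum _ fun l _ =>
    mul_nonneg (by linarith [hm l]) (newtonKernel_nonneg _)) 1

theorem tendsto_partialFactor {m : ℕ → ℝ} {c : ℕ → E3} (hm : ∀ l, 0 ≤ m l) {x : E3}
    (hS : Summable fun l => m l * nu (x - c l)) :
    Tendsto (fun L => partialFactor m c L x) atTop (𝓝 (regFactor m c x)) :=
  (summable_mul_newtonKernel hm hS).hasSum.tendsto_sum_nat.const_add 1

theorem tendsto_partialGrad {m : ℕ → ℝ} {c : ℕ → E3} (hm : ∀ l, 0 ≤ m l) {x : E3}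
    (hS : Summable fun l => m l * nu (x - c l)) (j : Fin 3) :
    Tendsto (fun L => partialGrad m c L j x) atTop (𝓝 (regGrad m c j x)) :=
  (summable_mul_newtonField hm hS j).hasSum.tendsto_sum_nat

theorem abs_partialGrad_le {m : ℕ → ℝ} {c : ℕ → E3} (hm : ∀ l, 0 ≤ m l) {x : E3}
    (hS : Summable fun l => m l * nu (x - c l)) (L : ℕ) (j : Fin 3) :
    |partialGrad m c L j x| ≤ 5 / 2 * ∑' l, m l * nu (x - c l) := by
  refine (Finset.abs_sum_le_sum_abs _ _).trans ?_
  rw [← tsum_mul_left]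
  refine (Finset.sum_le_sum fun l _ => ?_).trans
    ((hS.mul_left (5 / 2)).sum_le_tsum (Finset.range L) fun l _ =>
      mul_nonneg (by norm_num) (mul_nonneg (hm l) (nu_pos _).le))
  refine (abs_mul_newtonField_le hm j x l).trans ?_
  have := mul_le_mul_of_nonneg_left (nu_sq_le_nu (x - c l)) (hm l)
  linarith

theorem abs_partialField_le {m : ℕ → ℝ} {c : ℕ → E3} (hm : ∀ l, 0 ≤ m l) {x : E3}
    (hS : Summable fun l => m l * nu (x - c l)) (L : ℕ) (j : Fin 3) :
    |partialField m c L j x| ≤ 20 * ∑' l, m l * nu (x - c l) := by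
  have hU := one_le_partialFactor hm c L x
  rw [partialField, abs_mul, abs_div, abs_of_pos (zero_lt_one.trans_le hU), abs_neg,
    abs_of_pos (show (0 : ℝ) < 8 by norm_num)]
  have h1 := div_le_self (abs_nonneg (partialGrad m c L j x)) hU
  have h2 := abs_partialGrad_le hm hS L j
  linarith

namespace IsLocalizedBL

variable {m : ℕ → ℝ} {p : ℕ → E3} {lam : ℝ} {δ : ℕ → ℝ} {ε₀ C : ℝ} {g : TensorField}

/-- An almost nearest center absorbs everything: its own mass gives at most ε₀ and its interactions
at most 3δ_k. The potential is therefore bounded even if the total mass is infinite. -/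
theorem tsum_mul_nu_le_const (h : IsLocalizedBL m p lam δ ε₀ C g) (hδ : Summable δ) (x : E3) :
    ∑' l, m l * nu (x - lam • p l) ≤ ε₀ + 3 * ∑' k, δ k := by
  obtain ⟨k, hk⟩ := h.exists_almost_nearest x
  have h1 := h.tsum_mul_nu_le hk
  have h2 := hδ.le_tsum k fun l _ => (h.delta_pos l).le
  linarith [h.mass_le k]

/-- The defect between the ADM integrand and its regularized counterpart. -/
theorem abs_admIntegrand_add_le (h : IsLocalizedBL m p lam δ ε₀ C g) (hδ : Summable δ)
    {κ : ℝ} (hκ : 0 < κ)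
    (hpos : ∀ x v : E3, κ * ‖v‖ ^ 2 ≤ ∑ i, ∑ j, g x i j * v i * v j) {x : E3} {s : Finset ℕ}
    (hs : ∀ k, ‖x - lam • p k‖ ≤ 2 → k ∈ s) :
    |admIntegrand g x - -8 * (∑ j, regGrad m (fun k => lam • p k) j x * (x j / ‖x‖)) /
      regFactor m (fun k => lam • p k) x| ≤
      ∑ k ∈ s, 27 * (54 * C / κ * ε₀ + 20 * (ε₀ + 3 * ∑' k, δ k)) * nu (x - lam • p k) ^ 3 := by
  have hε : 0 < ε₀ := (h.mass_pos 0).trans_le (h.mass_le 0)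
  have hC := h.const_pos
  have hD : 0 ≤ ∑' k, δ k := tsum_nonneg fun k => (h.delta_pos k).le
  set Q := 54 * C / κ * ε₀ + 20 * (ε₀ + 3 * ∑' k, δ k) with hQ
  have hQ0 : 0 ≤ Q := by positivity
  have hterm : ∀ k ∈ s, 0 ≤ 27 * Q * nu (x - lam • p k) ^ 3 := fun k _ =>
    mul_nonneg (by positivity) (pow_pos (nu_pos _) 3).le
  by_cases hk : ∃ k, ‖x - lam • p k‖ ≤ 2
  · obtain ⟨k, hk⟩ := hk
    refine le_trans ?_ (Finset.single_le_sum hterm (hs k hk))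
    have h1 := h.abs_admIntegrand_inside_le hk hκ (hpos x)
    have h2 := h.abs_regGrad_radial_le x
    have h3 : ∑' l, m l * nu (x - lam • p l) ^ 2 ≤ ε₀ + 3 * ∑' k, δ k :=
      ((summable_mul_nu_sq (fun l => (h.mass_pos l).le) (h.summable_mul_nu x)).tsum_le_tsum
        (fun l => mul_le_mul_of_nonneg_left (nu_sq_le_nu _) (h.mass_pos l).le)
        (h.summable_mul_nu x)).trans (h.tsum_mul_nu_le_const hδ x)
    have hU := h.one_le_regFactor x
    set R := ∑ j, regGrad m (fun k => lam • p k) j x * (x j / ‖x‖)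
    set U := regFactor m (fun k => lam • p k) x
    have h4 : |-8 * R / U| ≤ 8 * |R| := by
      rw [abs_div, abs_mul, abs_neg, abs_of_pos (show (0 : ℝ) < 8 by norm_num),
        abs_of_pos (zero_lt_one.trans_le hU)]
      exact div_le_self (by positivity) hU
    have h5 : 54 * C / κ * m k ≤ 54 * C / κ * ε₀ :=
      mul_le_mul_of_nonneg_left (h.mass_le k) (by positivity)
    have h6 : |admIntegrand g x - -8 * R / U| ≤ Q := by
      refine (abs_sub _ _).trans ?_
      linarith
    have h7 : 1 ≤ 27 * nu (x - lam • p k) ^ 3 := by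
      have := one_le_pow₀ (n := 3) (one_le_three_mul_nu hk)
      linarith
    have := le_mul_of_one_le_right hQ0 h7
    linarith
  · push Not at hk
    rw [h.admIntegrand_outside hk, sub_self, abs_zero]
    exact Finset.sum_nonneg hterm

end IsLocalizedBL

/-- An error concentrated near a ball costs a bounded amount on any sphere, so only the number of
balls matters. -/
theorem abs_sphereIntegral_le_card_mul {c : ℕ → E3} {s : Finset ℕ} {a : ℝ} (ha : 0 ≤ a) {r : ℝ}
    (hr : 1 ≤ r) {H : E3 → ℝ} (hH : ∀ x, ‖x‖ = r → |H x| ≤ ∑ k ∈ s, a * nu (x - c k) ^ 3) :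
    |sphereIntegral r H| ≤ s.card * (a * nuSphereBound) := by
  have hc : ∀ k, Continuous fun x => a * nu (x - c k) ^ 3 := fun k =>
    continuous_const.mul ((continuous_nu_sub (c k)).pow 3)
  refine (abs_sphereIntegral_le (integrable_sphere_of_continuous
    (continuous_finsetSum _ fun k _ => hc k) r) (by linarith) hH).trans ?_
  rw [sphereIntegral, integral_finsetSum _ fun k _ => integrable_sphere_of_continuous (hc k) r,
    Finset.mul_sum, ← nsmul_eq_mul]
  refine Finset.sum_le_card_nsmul _ _ _ fun k _ => ?_
  have := mul_le_mul_of_nonneg_left (sphereIntegral_nu_pow_three_le (c k) hr) ha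
  rwa [← sphereIntegral_const_mul] at this

theorem exists_finset_of_encard_le {c : ℕ → E3} {N : ℕ}
    (hN : ∀ r : ℝ, 0 < r → {k : ℕ | |‖c k‖ - r| < 2}.encard ≤ N) {r : ℝ} (hr : 1 < r) :
    ∃ s : Finset ℕ, s.card ≤ 2 * N ∧ ∀ x : E3, ‖x‖ = r → ∀ k, ‖x - c k‖ ≤ 2 → k ∈ s := by
  -- The count is for open balls but closed ones are needed: |‖c_k‖ - r| ≤ 2 puts ‖c_k‖ within 1 of
  -- r + 1 or of r - 1, and r > 1 keeps both radii positive.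
  have h1 : ({k : ℕ | |‖c k‖ - (r + 1)| < 2} ∪ {k : ℕ | |‖c k‖ - (r - 1)| < 2}).encard ≤
      ((2 * N : ℕ) : ℕ∞) := by
    refine (Set.encard_union_le _ _).trans
      ((add_le_add (hN (r + 1) (by linarith)) (hN (r - 1) (by linarith))).trans (le_of_eq ?_))
    push_cast
    ring
  have hfin := Set.finite_of_encard_le_coe h1
  refine ⟨hfin.toFinset, ?_, fun x hx k hk => ?_⟩
  · rw [hfin.encard_eq_coe_toFinset_card] at h1
    exact_mod_cast h1
  · rw [Set.Finite.mem_toFinset]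
    have h2 := (abs_le.1 ((abs_norm_sub_norm_le x (c k)).trans hk))
    rw [hx] at h2
    rcases le_total r ‖c k‖ with h3 | h3
    · left
      change |‖c k‖ - (r + 1)| < 2
      rw [abs_lt]
      constructor <;> linarith
    · right
      change |‖c k‖ - (r - 1)| < 2
      rw [abs_lt]
      constructor <;> linarith

namespace IsLocalizedBL

variable {m : ℕ → ℝ} {p : ℕ → E3} {lam : ℝ} {δ : ℕ → ℝ} {ε₀ C : ℝ} {g : TensorField}

/-- Transfers the lower flux bound from finite sums to the full potential on a fixed sphere.
Dominated convergence applies because the partial fields are bounded uniformly in L and x; 60 is 20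
for each of three components. -/
theorem tendsto_sphereIntegral_sub_partialField (h : IsLocalizedBL m p lam δ ε₀ C g)
    (hδ : Summable δ) {r : ℝ} (hr : 0 < r) :
    Tendsto (fun L => sphereIntegral r fun x => admIntegrand g x -
        ∑ j, partialField m (fun k => lam • p k) L j x * (x j / ‖x‖)) atTop
      (𝓝 (sphereIntegral r fun x => admIntegrand g x -
        -8 * (∑ j, regGrad m (fun k => lam • p k) j x * (x j / ‖x‖)) /
          regFactor m (fun k => lam • p k) x)) := by
  have hm : ∀ l, 0 ≤ m l := fun l => (h.mass_pos l).le
  set c : ℕ → E3 := fun k => lam • p k with hc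
  set S := ε₀ + 3 * ∑' k, δ k
  have hcont : ∀ L, ContinuousOn (fun x : E3 => admIntegrand g x -
      ∑ j, partialField m c L j x * (x j / ‖x‖)) {0}ᶜ := fun L =>
    h.metric.continuousOn_admIntegrand.sub (continuousOn_sum_mul_div_norm fun j =>
      (contDiff_partialField hm c L j).continuous)
  have hadm := integrable_sphere_of_continuousOn h.metric.continuousOn_admIntegrand hr
  refine Tendsto.const_mul _ ?_
  refine tendsto_integral_of_dominated_convergence
    (fun ξ : Metric.sphere (0 : E3) 1 => |admIntegrand g (r • (ξ : E3))| + 60 * S)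
    (fun L => (integrable_sphere_of_continuousOn (hcont L) hr).aestronglyMeasurable)
    (hadm.abs.add (integrable_const _)) (fun L => .of_forall fun ξ => ?_)
    (.of_forall fun ξ => ?_)
  · set x := r • (ξ : E3)
    refine (abs_sub _ _).trans (add_le_add_right ?_ _)
    have h1 : ∀ j, |partialField m c L j x * (x j / ‖x‖)| ≤ 20 * S := fun j => by
      rw [abs_mul]
      have h2 : |x j / ‖x‖| ≤ 1 := by
        rw [abs_div, abs_norm]
        exact div_le_one_of_le₀ (abs_apply_le_norm x j) (norm_nonneg x)
      have h3 := abs_partialField_le hm (h.summable_mul_nu x) L j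
      have h4 := h.tsum_mul_nu_le_const hδ x
      refine (mul_le_of_le_one_right (abs_nonneg _) h2).trans (h3.trans ?_)
      linarith
    refine (Finset.abs_sum_le_sum_abs _ _).trans
      ((Finset.sum_le_sum fun j _ => h1 j).trans (le_of_eq ?_))
    simp
    ring
  · set x := r • (ξ : E3)
    have hU := (zero_lt_one.trans_le (h.one_le_regFactor x)).ne'
    refine tendsto_const_nhds.sub ?_
    have h1 : Tendsto (fun L => ∑ j, partialField m c L j x * (x j / ‖x‖)) atTop
        (𝓝 (∑ j, -8 * (regGrad m c j x / regFactor m c x) * (x j / ‖x‖))) :=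
      tendsto_finsetSum _ fun j _ => ((((tendsto_partialGrad hm (h.summable_mul_nu x) j).div
        (tendsto_partialFactor hm (h.summable_mul_nu x)) hU).const_mul (-8)).mul_const _)
    convert h1 using 2
    rw [Finset.mul_sum, Finset.sum_div]
    exact Finset.sum_congr rfl fun j _ => by ring

/-- With infinite total mass the flux of a uniformly positive metric diverges. -/
theorem tendsto_admFlux_atTop (h : IsLocalizedBL m p lam δ ε₀ C g) (hδ : Summable δ)
    (hmS : ¬Summable m) (hb : BoundedlyManyMeet (fun k => lam • p k) fun _ => 2)
    (hpos : IsUniformlyPositive g) : Tendsto (admFlux g) atTop atTop := by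
  obtain ⟨κ, hκ, hpos⟩ := hpos
  obtain ⟨N, hN⟩ := hb.exists_encard_le
  have hm : ∀ l, 0 ≤ m l := fun l => (h.mass_pos l).le
  set c : ℕ → E3 := fun k => lam • p k with hc
  have hε : 0 < ε₀ := (h.mass_pos 0).trans_le (h.mass_le 0)
  have hC := h.const_pos
  have hD : 0 ≤ ∑' k, δ k := tsum_nonneg fun k => (h.delta_pos k).le
  set S := ε₀ + 3 * ∑' k, δ k with hS
  set K := 1 + 3 / 2 * S with hK
  have hK0 : 0 < K := by positivity
  have hUK : ∀ L x, partialFactor m c L x ≤ K := fun L x => by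
    have h1 := partialFactor_le_regFactor hm (h.summable_mul_nu x) L
    have h2 := regFactor_sub_one_le hm (h.summable_mul_nu x)
    have h3 := h.tsum_mul_nu_le_const hδ x
    change partialFactor m c L x ≤ regFactor m c x at h1
    change regFactor m c x - 1 ≤ _ at h2
    linarith
  set Q := 27 * (54 * C / κ * ε₀ + 20 * S) with hQ
  have hQ0 : 0 ≤ Q := by positivity
  have hν0 : 0 ≤ nuSphereBound := (sphereIntegral_nu_pow_three_nonneg 0 1).trans
    (sphereIntegral_nu_pow_three_le 0 le_rfl)
  set P := (2 * N : ℕ) * (Q * nuSphereBound) with hP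
  rw [tendsto_atTop]
  intro A
  have hsum := (not_summable_iff_tendsto_nat_atTop_of_nonneg hm).1 hmS
  -- Chosen so that the flux guaranteed by the first n masses exceeds the target `A` plus the
  -- worst-case defect `P`.
  obtain ⟨n, hn⟩ := (hsum.eventually_ge_atTop ((A + P) * K / (16 * Real.pi))).exists
  have hrl : ∀ᶠ r : ℝ in atTop, ∀ l ∈ Finset.range n, ‖c l‖ + 2 ≤ r :=
    (Filter.eventually_all_finset _).2 fun l _ => eventually_ge_atTop _
  filter_upwards [hrl, eventually_gt_atTop 1] with r hrl hr1
  have hr0 : 0 < r := by linarith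
  obtain ⟨s, hcard, hs⟩ := exists_finset_of_encard_le hN hr1
  have hlim := h.tendsto_sphereIntegral_sub_partialField hδ hr0
  have hle := abs_sphereIntegral_le_card_mul hQ0 hr1.le fun x hx =>
    h.abs_admIntegrand_add_le hδ hκ hpos (hs x hx)
  have hle2 : (s.card : ℝ) * (Q * nuSphereBound) ≤ P := by
    rw [hP]
    gcongr
  have hbound : 16 * Real.pi / K * ∑ l ∈ Finset.range n, m l - P ≤ admFlux g r := by
    -- For every L ≥ n the flux minus that of the partial field is at most this bound; so is its
    -- limit, which is the defect on the balls and is at least -P.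
    have hlim2 := le_of_tendsto hlim (b := admFlux g r -
      16 * Real.pi / K * ∑ l ∈ Finset.range n, m l) (by
        filter_upwards [eventually_ge_atTop n] with L hL
        rw [sphereIntegral_sub h.metric.continuousOn_admIntegrand
          (continuousOn_sum_mul_div_norm fun j => (contDiff_partialField hm c L j).continuous) hr0]
        have := le_sphereFlux_partialField hm c hL (hUK L) hr0
          fun l hl => hrl l (Finset.mem_range.2 hl)
        exact sub_le_sub_left this _)
    have := neg_le_of_abs_le (hle.trans hle2)
    linarith
  refine le_trans ?_ hbound
  have hπ := Real.pi_pos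
  have : A + P ≤ 16 * Real.pi / K * ∑ l ∈ Finset.range n, m l := by
    calc A + P = 16 * Real.pi / K * ((A + P) * K / (16 * Real.pi)) := by field_simp
      _ ≤ _ := by gcongr
  linarith

end IsLocalizedBL

theorem proposition6p1 :
    ∃ η : ℝ, 0 < η ∧
      ∀ (m : ℕ → ℝ) (p : ℕ → E3) (lam : ℝ) (δ : ℕ → ℝ) (ε₀ C : ℝ) (g : TensorField),
        IsLocalizedBL m p lam δ ε₀ C g → Summable δ →
        -- infinite total mass
        (¬ Summable m → BoundedlyManyMeet (fun k => lam • p k) (fun _ => 2) →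
          (IsUniformlyPositive g → Tendsto (admFlux g) atTop atTop) ∧
            ¬ IsAsymptoticallyFlat g) ∧
        -- finite total mass
        (Summable m →
          (∃ L : ℝ, Tendsto (admFlux g) atTop (𝓝 L) ∧ (∑' k, δ k < η → 0 < L)) ∧
          (BoundedlyManyMeet (fun k => lam • p k) (fun r => r / 10) →
            (∀ j k, j < k → (2 / 7) * ‖lam • p j‖ ≤ ‖lam • p k - lam • p j‖) →
              Tendsto (admFlux g) atTop (𝓝 (16 * Real.pi * ∑' k, m k)))) := by
  -- The choice of `η` is arbitrary: the limit is 16π times the total mass, hence positive.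
  refine ⟨1, one_pos, fun m p lam δ ε₀ C g h hδ => ⟨fun hmS hb => ⟨fun hpos =>
    h.tendsto_admFlux_atTop hδ hmS hb hpos, fun hAF =>
    hmS (h.summable_mass_of_isAsymptoticallyFlat hδ hb hAF)⟩, fun hmS =>
    ⟨⟨_, h.tendsto_admFlux hδ hmS, fun _ => ?_⟩, fun _ _ => h.tendsto_admFlux hδ hmS⟩⟩⟩
  have := hmS.tsum_pos (fun k => (h.mass_pos k).le) 0 (h.mass_pos 0)
  positivity
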